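/- Let $F_1,F_2$ be finite sets of positive integers, not both empty, with $k_1$ and $k_2$ elements, let $k=k_1+k_2$ and $\mathcal F=(F_1,F_2)$. Let $\alpha,\beta,N$ be real numbers with $\alpha,\beta,\alpha+\beta\notin\{-1,-2,\dots\}$ and, if $F_2\neq\emptyset$, also $\alpha-\beta\notin\{-1,-2,\dots\}$ and $\beta-\max F_2-1\notin\{-1,-2,\dots\}$. Write $(a)_j=a(a+1)\cdots(a+j-1)$, $s_j^u(x)=(u-x)_j$, $\lambda(x)=x(x+\alpha+\beta+1)$. For real $a,b,M$ with $a\notin\{-1,-2,\dots\}$ let $$h_n^{a,b,M}(x)=\sum_{j=0}^{n}\frac{(-n)_j(-x)_j(n+a+b+1)_j(-M+j)_{n-j}}{(a+1)_j\,j!}$$ be the Hahn polynomials, i.e. $h_n^{a,b,M}(x)=(-M)_n\,{}_3F_2\left(-n,-x,n+a+b+1;\,a+1,-M;\,1\right)$. Put $$u_{\mathcal F}=\sum_{f\in F_1}f+\sum_{f\in F_2}f-\binom{k_1+1}{2}-\binom{k_2}{2},\qquad \sigma_{\mathcal F}=\{u_{\mathcal F},u_{\mathcal F}+1,\dots\}\setminus\{u_{\mathcal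 F}+f: f\in F_1\}.$$ For $j\ge 1$ let $c_j(x)$ be the column of length $k$ whose entries are $h_f^{\alpha,\beta,N}(x+j-1)$, $f\in F_1$ (in increasing order), followed by $s_{k-j+1}^{N-k+1}(x)\,s_{j-1}^{N+\beta+1}(x+j-1)\,h_f^{\alpha,-\beta,\beta+N}(x+j-1)$, $f\in F_2$ (in increasing order), for $1\le j\le k+1$. Define the rational functions $$\Omega_{\mathcal F}(x)=\frac{\det\big(c_1(x),\dots,c_{k-1}(x),c_k(x)\big)}{\prod_{i=1}^{k_2}(N-x-k+1)_{k_2-i+1}(N+\beta-x-i+2)_{i-1}},\qquad \Lambda_{\mathcal F}(x)=\frac{\det\big(c_1(x),\dots,c_{k-1}(x),c_{k+1}(x)\big)}{\prod_{i=1}^{k_2}(N-x-k+1)_{k_2-i+1}(N+\beta-x-i+2)_{i-1}},$$ and, for $n\in\sigma_{\mathcal F}$, $$h_n^{\mathcal F}(x)=\frac{\det\begin{pmatrix}h_{n-u_{\mathcal F}}^{\alpha,\beta,N}(x)&h_{n-u_{\mathcal F}}^{\alpha,\beta,N}(x+1)&\cdots&h_{n-u_{\mathcal F}}^{\alpha,\beta,N}(x+k)\\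 c_1(x)&c_2(x)&\cdots&c_{k+1}(x)\end{pmatrix}}{\prod_{i=1}^{k_2}(N-x-k+1)_{k_2-i}(N+\beta-x-i+2)_{i-1}}.$$ Then $\Omega_{\mathcal F}\neq0$, each $h_n^{\mathcal F}$, $n\in\sigma_{\mathcal F}$, is a nonzero polynomial, and these polynomials are common eigenfunctions of the second order difference operator with rational coefficients $$D_{\mathcal F}f(x)=h_{-1}(x)f(x-1)+h_0(x)f(x)+h_1(x)f(x+1),$$ where, with $\Delta f(x)=f(x+1)-f(x)$, $$h_{-1}(x)=\frac{x(x-\beta-N-1+k_2)\,\Omega_{\mathcal F}(x+1)}{\Omega_{\mathcal F}(x)},\qquad h_1(x)=\frac{(x+\alpha+k+1)(x-N+k_1)\,\Omega_{\mathcal F}(x)}{\Omega_{\mathcal F}(x+1)},$$ $$h_0(x)=-(x+k)(x-\beta-N-1+k)-(x+\alpha+1+k)(x-N+k)+\Delta\left(\frac{(x+\alpha+k)(x-N-1+k)\,\Lambda_{\mathcal F}(x)}{\Omega_{\mathcal F}(x)}\right).$$ More precisely, as an identity of rational functions, $$D_{\mathcal F}(h_n^{\mathcal F})=\lambda(n-u_{\mathcal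 F})\,h_n^{\mathcal F},\qquad n\in\sigma_{\mathcal F}.$$ -/

import Mathlib

noncomputable section

namespace ExcHahn

open Polynomial

/-- The numerical Pochhammer symbol `(a)_j = a (a+1) ⋯ (a+j-1)`. -/
def poch (a : ℝ) (j : ℕ) : ℝ := (ascPochhammer ℝ j).eval a

/-- The polynomial `(u - x)_j` in `x`, that is `s_j^u(x)`. -/
def sPoly (u : ℝ) (j : ℕ) : ℝ[X] := (ascPochhammer ℝ j).comp (C u - X)

/-- The polynomial `p(x + c)`. -/
def polyShift (c : ℝ) (p : ℝ[X]) : ℝ[X] := p.comp (X + C c)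

/-- The Hahn polynomial
`h_n^{α,β,N}(x) = (-N)_n ₃F₂(-n, -x, n+α+β+1; α+1, -N; 1)`. The quotient `(-N)_n / (-N)_j` is
written as `(-N+j)_{n-j}`, so that the formula makes sense for every real `N`. -/
def hahn (α β N : ℝ) (n : ℕ) : ℝ[X] :=
  ∑ j ∈ Finset.range (n + 1),
    C (poch (-(n : ℝ)) j * poch ((n : ℝ) + α + β + 1) j * poch (-N + (j : ℝ)) (n - j) /
        (poch (α + 1) j * (j.factorial : ℝ))) * sPoly 0 j

/-- `λ^{α,β}(x) = x (x + α + β + 1)`. -/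
def lam (α β x : ℝ) : ℝ := x * (x + α + β + 1)

/-- `u_F = ∑_{f ∈ F₁} f + ∑_{f ∈ F₂} f - C(k₁+1, 2) - C(k₂, 2)`, a nonnegative integer when
the elements of `F₁` and `F₂` are positive. -/
def uF (F₁ F₂ : Finset ℕ) : ℕ :=
  ∑ f ∈ F₁, f + ∑ f ∈ F₂, f - ((F₁.card + 1).choose 2 + F₂.card.choose 2)

/-- `σ_F = {u_F, u_F + 1, …} \ {u_F + f : f ∈ F₁}`. -/
def sigmaF (F₁ F₂ : Finset ℕ) : Set ℕ :=
  {n | uF F₁ F₂ ≤ n ∧ ∀ f ∈ F₁, n ≠ uF F₁ F₂ + f}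

/-- The entry `h_f^{α,β,N}(x + i)`, `i ≥ 0`, of a row indexed by `f ∈ F₁`. -/
def entry₁ (α β N : ℝ) (f i : ℕ) : ℝ[X] := polyShift (i : ℝ) (hahn α β N f)

/-- The entry `s_{k-i}^{N-k+1}(x) s_i^{N+β+1}(x+i) h_f^{α,-β,β+N}(x+i)`, `0 ≤ i ≤ k`, of a row
indexed by `f ∈ F₂`. -/
def entry₂ (α β N : ℝ) (k f i : ℕ) : ℝ[X] :=
  sPoly (N - k + 1) (k - i) * polyShift (i : ℝ) (sPoly (N + β + 1) i) *
    polyShift (i : ℝ) (hahn α (-β) (β + N) f)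

/-- The `k = k₁ + k₂` rows indexed by `F₁` and then by `F₂`, each in increasing order; the second
argument is the translation `i`. -/
def rows (α β N : ℝ) (F₁ F₂ : Finset ℕ) : Fin (F₁.card + F₂.card) → ℕ → ℝ[X] :=
  Fin.append (fun a => entry₁ α β N (F₁.orderEmbOfFin rfl a))
    (fun b => entry₂ α β N (F₁.card + F₂.card) (F₂.orderEmbOfFin rfl b))

/-- `∏_{i=1}^{k₂} (N-x-k+1)_{k₂-i} (N+β-x-i+2)_{i-1}`. -/
def denH (β N : ℝ) (k k₂ : ℕ) : ℝ[X] :=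
  ∏ i ∈ Finset.Icc 1 k₂, sPoly (N - k + 1) (k₂ - i) * sPoly (N + β - i + 2) (i - 1)

/-- `∏_{i=1}^{k₂} (N-x-k+1)_{k₂-i+1} (N+β-x-i+2)_{i-1}`. -/
def denΩ (β N : ℝ) (k k₂ : ℕ) : ℝ[X] :=
  ∏ i ∈ Finset.Icc 1 k₂, sPoly (N - k + 1) (k₂ - i + 1) * sPoly (N + β - i + 2) (i - 1)

/-- `h_n^{α,β,N;F}` as a rational function, for `n ≥ u_F`: a `(k+1) × (k+1)` determinant, whose
first row is `h_{n-u_F}^{α,β,N}(x+i)`, `0 ≤ i ≤ k`, divided by `denH`. -/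
def hF (α β N : ℝ) (F₁ F₂ : Finset ℕ) (n : ℕ) : RatFunc ℝ :=
  algebraMap ℝ[X] (RatFunc ℝ)
      (Matrix.det (Matrix.of fun a i : Fin (F₁.card + F₂.card + 1) =>
        (Fin.cons (entry₁ α β N (n - uF F₁ F₂)) (rows α β N F₁ F₂) :
          Fin (F₁.card + F₂.card + 1) → ℕ → ℝ[X]) a i)) /
    algebraMap ℝ[X] (RatFunc ℝ) (denH β N (F₁.card + F₂.card) F₂.card)

/-- `Ω_F`: the columns are the translations `0, 1, …, k-1`. -/
def Omega (α β N : ℝ) (F₁ F₂ : Finset ℕ) : RatFunc ℝ :=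
  algebraMap ℝ[X] (RatFunc ℝ)
      (Matrix.det (Matrix.of fun a i : Fin (F₁.card + F₂.card) => rows α β N F₁ F₂ a i)) /
    algebraMap ℝ[X] (RatFunc ℝ) (denΩ β N (F₁.card + F₂.card) F₂.card)

/-- `Λ_F`: the columns are the translations `0, 1, …, k-2, k`. -/
def Lambda (α β N : ℝ) (F₁ F₂ : Finset ℕ) : RatFunc ℝ :=
  algebraMap ℝ[X] (RatFunc ℝ)
      (Matrix.det (Matrix.of fun a i : Fin (F₁.card + F₂.card) =>
        rows α β N F₁ F₂ a
          (if (i : ℕ) + 1 = F₁.card + F₂.card then F₁.card + F₂.card else i))) /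
    algebraMap ℝ[X] (RatFunc ℝ) (denΩ β N (F₁.card + F₂.card) F₂.card)

/-- The shift operator `f(x) ↦ f(x + l)` on rational functions. -/
def Sh (l : ℤ) : RatFunc ℝ ≃ₐ[ℝ] RatFunc ℝ :=
  IsFractionRing.algEquivOfAlgEquiv (algEquivAevalXAddC (l : ℝ))

/-- `Δ f (x) = f(x + 1) - f(x)`. -/
def Delta (f : RatFunc ℝ) : RatFunc ℝ := Sh 1 f - f

/-- The coefficient `h_{-1}(x) = x (x-β-N-1+k₂) Ω_F(x+1) / Ω_F(x)`. -/
def coeffNegOne (α β N : ℝ) (F₁ F₂ : Finset ℕ) : RatFunc ℝ :=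
  RatFunc.X * (RatFunc.X + RatFunc.C (-β - N - 1 + F₂.card)) * Sh 1 (Omega α β N F₁ F₂) /
    Omega α β N F₁ F₂

/-- The coefficient
`h_0(x) = -(x+k)(x-β-N-1+k) - (x+α+1+k)(x-N+k) + Δ((x+α+k)(x-N-1+k) Λ_F(x) / Ω_F(x))`. -/
def coeffZero (α β N : ℝ) (F₁ F₂ : Finset ℕ) : RatFunc ℝ :=
  Delta ((RatFunc.X + RatFunc.C (α + (F₁.card + F₂.card : ℕ))) *
        (RatFunc.X + RatFunc.C (-N - 1 + (F₁.card + F₂.card : ℕ))) *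
        Lambda α β N F₁ F₂ / Omega α β N F₁ F₂) -
    (RatFunc.X + RatFunc.C ((F₁.card + F₂.card : ℕ) : ℝ)) *
      (RatFunc.X + RatFunc.C (-β - N - 1 + (F₁.card + F₂.card : ℕ))) -
    (RatFunc.X + RatFunc.C (α + 1 + (F₁.card + F₂.card : ℕ))) *
      (RatFunc.X + RatFunc.C (-N + (F₁.card + F₂.card : ℕ)))

/-- The coefficient `h_1(x) = (x+α+k+1)(x-N+k₁) Ω_F(x) / Ω_F(x+1)`. -/
def coeffOne (α β N : ℝ) (F₁ F₂ : Finset ℕ) : RatFunc ℝ :=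
  (RatFunc.X + RatFunc.C (α + (F₁.card + F₂.card : ℕ) + 1)) *
      (RatFunc.X + RatFunc.C (-N + F₁.card)) * Omega α β N F₁ F₂ /
    Sh 1 (Omega α β N F₁ F₂)

/-- The second order difference operator `D_F = h_{-1} Sh_{-1} + h_0 Sh_0 + h_1 Sh_1`, acting on
rational functions. -/
def DF (α β N : ℝ) (F₁ F₂ : Finset ℕ) : Module.End ℝ (RatFunc ℝ) :=
  LinearMap.mulLeft ℝ (coeffNegOne α β N F₁ F₂) ∘ₗ (Sh (-1)).toLinearMap +
    LinearMap.mulLeft ℝ (coeffZero α β N F₁ F₂) ∘ₗ (Sh 0).toLinearMap +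
    LinearMap.mulLeft ℝ (coeffOne α β N F₁ F₂) ∘ₗ (Sh 1).toLinearMap

end ExcHahn

end

/-! The theorem is a Darboux–Crum transformation of the Hahn difference operator. The Hahn operator
with parameters `α, β, N` has two families of eigenfunctions: its own Hahn polynomials, with
eigenvalue `λ(f)`, and `w h_f^{α,-β,β+N}`, with eigenvalue `λ(f-β)`, where `w(x+1)/w(x) =
(N+β-x)/(N-x)`. The rows indexed by `F₁` and `F₂` are these two kinds of seeds, the second kind
multiplied by `(N-k+1-x)_k / w(x)`.

A function `g` is replaced by the sequence `m ↦ g(x+m)`, divided by `w(x)` for the second kind, so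
that `w` itself never appears. On sequences with values in `K = ℝ(x)` the Hahn operator is
`K`-linear, although shifting `x` is not, so linear algebra over `K` applies. What is lost is
recorded by semilinearity: `φ(m+1) = ρ σ(φ(m))`, with `σ` the shift of `x`.

Three facts carry the proof. The parameter conditions make the eigenvalues distinct, so the seeds
are independent, and independent semilinear sequences have a nonzero Casorati determinant
(`casorati_ne_zero`); this gives `Ω ≠ 0` and `h_n^F ≠ 0`. The Casorati operator of the seeds
intertwines the Hahn operator with another second order operator (`crum`); `DF_hF` turns this into
the stated eigenvalue equation by tracking the normalizing products. Polynomiality follows from the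
Leibniz expansion of the determinant (`denH_dvd_det`). -/

noncomputable section

namespace ExcHahn

/-! ### Casorati determinants and the Darboux–Crum identity over a field. -/

section Casorati

variable {K : Type*} [Field K]

/-- The Casorati determinant `det (φ_a (m + b))`. -/
def casorati {k : ℕ} (φ : Fin k → ℤ → K) (m : ℤ) : K :=
  Matrix.det (Matrix.of fun a b : Fin k => φ a (m + (b : ℕ)))

/-- The signed minor of the Casorati array with the column `m + i` left out. -/
def casoratiMinor {k : ℕ} (φ : Fin k → ℤ → K) (i : ℕ) (m : ℤ) : K :=
  (-1) ^ i * Matrix.det (Matrix.of fun a b : Fin k =>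
    φ a (m + ((if (b : ℕ) < i then (b : ℕ) else b + 1 : ℕ) : ℤ)))

/-- The order `k` difference operator, evaluated at `m`, that annihilates the sequences `φ a`. -/
def casoratiOp {k : ℕ} (φ : Fin k → ℤ → K) (m : ℤ) : (ℤ → K) →ₗ[K] K :=
  ∑ i ∈ Finset.range (k + 1), casoratiMinor φ i m • LinearMap.proj (m + (i : ℤ))

lemma casoratiOp_apply {k : ℕ} (φ : Fin k → ℤ → K) (m : ℤ) (ψ : ℤ → K) :
    casoratiOp φ m ψ = ∑ i ∈ Finset.range (k + 1), casoratiMinor φ i m * ψ (m + (i : ℤ)) := by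
  simp [casoratiOp]

lemma casoratiOp_eq_casorati {k : ℕ} (φ : Fin k → ℤ → K) (m : ℤ) (ψ : ℤ → K) :
    casoratiOp φ m ψ = casorati (Fin.cons ψ φ : Fin (k + 1) → ℤ → K) m := by
  rw [casoratiOp_apply, casorati, Matrix.det_succ_row_zero, Finset.sum_range]
  refine Finset.sum_congr rfl fun i _ => ?_
  have h : Matrix.of (fun a b : Fin k =>
      φ a (m + ((if (b : ℕ) < i then (b : ℕ) else b + 1 : ℕ) : ℤ))) =
      (Matrix.of fun a b : Fin (k + 1) =>
        (Fin.cons ψ φ : Fin (k + 1) → ℤ → K) a (m + (b : ℕ))).submatrix Fin.succ i.succAbove := by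
    ext a b
    simp only [Matrix.of_apply, Matrix.submatrix_apply, Fin.cons_succ]
    congr 3
    simp only [Fin.succAbove, Fin.lt_def, Fin.val_castSucc]
    split_ifs <;> simp
  rw [casoratiMinor, h]
  simp only [Matrix.of_apply, Fin.cons_zero]
  ring

lemma casoratiOp_self {k : ℕ} (φ : Fin k → ℤ → K) (m : ℤ) (a : Fin k) :
    casoratiOp φ m (φ a) = 0 := by
  rw [casoratiOp_eq_casorati, casorati]
  refine Matrix.det_zero_of_row_eq (i := 0) (j := a.succ) (Fin.succ_ne_zero a).symm ?_
  ext b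
  simp

lemma casoratiMinor_last {k : ℕ} (φ : Fin k → ℤ → K) (m : ℤ) :
    casoratiMinor φ k m = (-1) ^ k * casorati φ m := by
  simp [casoratiMinor, casorati]

lemma casoratiMinor_zero {k : ℕ} (φ : Fin k → ℤ → K) (m : ℤ) :
    casoratiMinor φ 0 m = casorati φ (m + 1) := by
  simp only [casoratiMinor, casorati, pow_zero, one_mul, Nat.not_lt_zero, if_false]
  congr 2
  ext a b
  push_cast
  congr 1
  ring

lemma exists_interpolation {k : ℕ} {φ : Fin k → ℤ → K} {m : ℤ} (h : casorati φ m ≠ 0)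
    (ψ : ℤ → K) : ∃ c : Fin k → K, ∀ i < k, ψ (m + (i : ℤ)) = (∑ a, c a • φ a) (m + (i : ℤ)) := by
  set M : Matrix (Fin k) (Fin k) K := Matrix.of fun a b : Fin k => φ a (m + (b : ℕ))
  have hM : IsUnit M.det := isUnit_iff_ne_zero.mpr h
  refine ⟨Matrix.vecMul (fun i : Fin k => ψ (m + (i : ℕ))) M⁻¹, fun i hi => ?_⟩
  have := congrFun (Matrix.vecMul_vecMul (fun i : Fin k => ψ (m + (i : ℕ))) M⁻¹ M) ⟨i, hi⟩
  rw [Matrix.nonsing_inv_mul _ hM, Matrix.vecMul_one] at this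
  simp only at this
  rw [← this]
  simp [Matrix.vecMul, dotProduct, M]

lemma casorati_semilinear {k : ℕ} {φ : Fin k → ℤ → K} {σ : K ≃+* K} {ρ : Fin k → K}
    (hφ : ∀ a m, φ a (m + 1) = ρ a * σ (φ a m)) (m : ℤ) :
    casorati φ (m + 1) = (∏ a, ρ a) * σ (casorati φ m) := by
  rw [casorati, casorati, RingEquiv.map_det, ← Matrix.det_mul_column]
  congr 1
  ext a b
  simp only [Matrix.of_apply, RingEquiv.mapMatrix_apply, Matrix.map_apply, ← hφ]
  congr 1
  ring

/-- By semilinearity, one zero of the determinant forces zeros at every `m`. Then `φ 0` satisfies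
the order `k` recurrence of the remaining sequences. By induction its two end coefficients never
vanish, so a solution is determined by `k` consecutive values and `φ 0` lies in the span of the
others. -/
lemma casorati_ne_zero {k : ℕ} {φ : Fin k → ℤ → K} {σ : K ≃+* K} {ρ : Fin k → K}
    (hρ : ∀ a, ρ a ≠ 0) (hφ : ∀ a m, φ a (m + 1) = ρ a * σ (φ a m))
    (hli : LinearIndependent K φ) (m : ℤ) : casorati φ m ≠ 0 := by
  induction k generalizing m with
  | zero => simp [casorati]
  | succ k ih =>
    intro h0
    have hstep : ∀ m, casorati φ (m + 1) = 0 ↔ casorati φ m = 0 := fun m => by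
      rw [casorati_semilinear hφ, mul_eq_zero, or_iff_right (Finset.prod_ne_zero_iff.mpr
        fun a _ => hρ a), map_eq_zero_iff σ σ.injective]
    have hall : ∀ m, casorati φ m = 0 := fun n => by
      have key : ∀ d : ℤ, casorati φ (m + d) = 0 := fun d => by
        induction d with
        | zero => simpa using h0
        | succ i hi => rw [← add_assoc, hstep]; exact hi
        | pred i hi =>
          rw [← hstep]
          convert hi using 2
          ring
      simpa using key (n - m)
    set φ' : Fin k → ℤ → K := fun a => φ a.succ
    have hli' := (linearIndependent_finSucc.mp hli).1
    have hnotin := (linearIndependent_finSucc.mp hli).2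
    have hne := ih (φ := φ') (ρ := fun a => ρ a.succ) (fun a => hρ _) (fun a m => hφ _ m) hli'
    obtain ⟨c, hc⟩ := exists_interpolation (hne 0) (φ 0)
    set η : ℤ → K := φ 0 - ∑ a, c a • φ' a with hη
    have hL : ∀ m, casoratiOp φ' m η = 0 := fun m => by
      have hcons : (Fin.cons (φ 0) φ' : Fin (k + 1) → ℤ → K) = φ := Fin.cons_self_tail φ
      rw [hη, map_sub, casoratiOp_eq_casorati, hcons, hall, map_sum]
      simp [casoratiOp_self]
    -- The `k` zeros of `η` obtained by interpolation spread upwards through the last coefficient of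
    -- the recurrence and downwards through the first one.
    have hzero : ∀ m : ℤ, ∀ i < k + 1, η (m + (i : ℤ)) = 0 := by
      have hlast : ∀ m : ℤ, (∀ i < k, η (m + (i : ℤ)) = 0) → ∀ i < k + 1, η (m + (i : ℤ)) = 0 := by
        intro m hm i hi
        rcases Nat.lt_succ_iff_lt_or_eq.mp hi with hi | rfl
        · exact hm i hi
        · have := hL m
          rw [casoratiOp_apply, Finset.sum_range_succ, Finset.sum_eq_zero, zero_add,
            casoratiMinor_last] at this
          · exact (mul_eq_zero.mp this).resolve_left
              (mul_ne_zero (pow_ne_zero _ (by simp)) (hne m))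
          · intro j hj
            rw [hm j (Finset.mem_range.mp hj), mul_zero]
      intro m
      induction m with
      | zero =>
        refine hlast 0 fun i hi => ?_
        rw [hη, Pi.sub_apply, sub_eq_zero]
        exact hc i hi
      | succ n hn =>
        refine hlast _ fun i hi => ?_
        have := hn (i + 1) (by omega)
        push_cast at this
        rw [← this]
        congr 1
        ring
      | pred n hn =>
        intro i hi
        have hpos : ∀ i < k, η (-(n : ℤ) - 1 + ((i + 1 : ℕ) : ℤ)) = 0 := fun i hi => by
          rw [← hn i (by omega)]
          congr 1
          push_cast
          ring
        rcases i with _ | i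
        · have := hL (-(n : ℤ) - 1)
          rw [casoratiOp_apply, Finset.sum_range_succ', Finset.sum_eq_zero, zero_add,
            casoratiMinor_zero] at this
          · exact (mul_eq_zero.mp this).resolve_left (hne _)
          · intro j hj
            rw [hpos j (Finset.mem_range.mp hj), mul_zero]
        · exact hpos i (by omega)
    apply hnotin
    have : φ 0 = ∑ a, c a • φ' a := by
      rw [← sub_eq_zero]
      ext m
      simpa [hη] using hzero m 0 (by omega)
    rw [this]
    exact Submodule.sum_mem _ fun a _ =>
      Submodule.smul_mem _ _ (Submodule.subset_span ⟨a, rfl⟩)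

/-- The difference operator `A Sh_1 + B + C Sh_{-1}` on sequences. -/
def seqOp (A B C : ℤ → K) : Module.End K (ℤ → K) where
  toFun ψ m := A m * ψ (m + 1) + B m * ψ m + C m * ψ (m - 1)
  map_add' ψ₁ ψ₂ := by ext m; simp only [Pi.add_apply]; ring
  map_smul' c ψ := by ext m; simp only [Pi.smul_apply, smul_eq_mul, RingHom.id_apply]; ring

lemma seqOp_apply (A B C ψ : ℤ → K) (m : ℤ) :
    seqOp A B C ψ m = A m * ψ (m + 1) + B m * ψ m + C m * ψ (m - 1) := rfl

/-- A semilinear sequence which solves the eigenvalue equation at `0` solves it everywhere. -/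
lemma seqOp_eigen {A B C : ℤ → K} {σ : K ≃+* K} (hA : ∀ m, A (m + 1) = σ (A m))
    (hB : ∀ m, B (m + 1) = σ (B m)) (hC : ∀ m, C (m + 1) = σ (C m)) {φ : ℤ → K} {ρ μ : K}
    (hρ : ρ ≠ 0) (hφ : ∀ m, φ (m + 1) = ρ * σ (φ m)) (hμ : σ μ = μ)
    (h0 : A 0 * φ 1 + B 0 * φ 0 + C 0 * φ (-1) = μ * φ 0) :
    seqOp A B C φ = μ • φ := by
  -- The defect of the eigenvalue equation is semilinear with the same multiplier, so its vanishing
  -- propagates in both directions.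
  have hstep : ∀ m, seqOp A B C φ (m + 1) - μ * φ (m + 1) =
      ρ * σ (seqOp A B C φ m - μ * φ m) := fun m => by
    have h1 := hφ (m - 1)
    rw [sub_add_cancel] at h1
    simp only [seqOp_apply, add_sub_cancel_right, hA, hB, hC, map_sub, map_add, map_mul, hμ]
    linear_combination σ (A m) * hφ (m + 1) + σ (B m) * hφ m + σ (C m) * h1 - μ * hφ m
  have hz : ∀ m, seqOp A B C φ m - μ * φ m = 0 := fun m => by
    induction m with
    | zero => simpa [seqOp_apply, sub_eq_zero] using h0
    | succ i hi => rw [hstep, hi]; simp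
    | pred i hi =>
      have := hstep (-(i : ℤ) - 1)
      rw [sub_add_cancel, hi] at this
      exact (map_eq_zero_iff σ σ.injective).mp ((mul_eq_zero.mp this.symm).resolve_left hρ)
  ext m
  simpa [sub_eq_zero] using hz m

/-- The Darboux–Crum identity: the operator `casoratiOp φ` intertwines `A Sh_1 + B + C Sh_{-1}`
with a second order operator. -/
theorem crum {k : ℕ} (hk : 0 < k) {φ : Fin k → ℤ → K} {A B C : ℤ → K} {μ : Fin k → K}
    (hW : ∀ m, casorati φ m ≠ 0) (hφ : ∀ a, seqOp A B C (φ a) = μ a • φ a) (ψ : ℤ → K) :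
    let W' : ℤ → K := fun m => Matrix.det (Matrix.of fun a b : Fin k =>
      φ a (m + ((if (b : ℕ) + 1 = k then k else (b : ℕ) : ℕ) : ℤ)))
    A k * casorati φ 0 / casorati φ 1 * casoratiOp φ 1 ψ +
      (B k + A k * W' 1 / casorati φ 1 - A (k - 1) * W' 0 / casorati φ 0) * casoratiOp φ 0 ψ +
      C 0 * casorati φ 1 / casorati φ 0 * casoratiOp φ (-1) ψ =
    casoratiOp φ 0 (seqOp A B C ψ) := by
  intro W'
  obtain ⟨n, rfl⟩ : ∃ n, k = n + 1 := ⟨k - 1, by omega⟩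
  have hM : ∀ m, casoratiMinor φ n m = (-1) ^ n * W' m := fun m => by
    simp only [casoratiMinor, W']
    refine congrArg _ (congrArg Matrix.det (Matrix.ext fun a b => ?_))
    have := b.2
    refine congrArg (φ a) (congrArg (fun j : ℕ => m + (j : ℤ)) ?_)
    split_ifs <;> omega
  -- `E` is the difference of the two sides as a functional of `ψ`. It kills every seed, so `ψ` may
  -- be replaced by `η`, which vanishes at `0, …, k-1`. Only `η(-1)`, `η(k)` and `η(k+1)` survive,
  -- and the three coefficients are exactly those that cancel them.
  set E : (ℤ → K) →ₗ[K] K :=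
    (A (n + 1 : ℕ) * casorati φ 0 / casorati φ 1) • casoratiOp φ 1 +
      (B (n + 1 : ℕ) + A (n + 1 : ℕ) * W' 1 / casorati φ 1 -
        A ((n + 1 : ℕ) - 1) * W' 0 / casorati φ 0) • casoratiOp φ 0 +
      (C 0 * casorati φ 1 / casorati φ 0) • casoratiOp φ (-1) -
    casoratiOp φ 0 ∘ₗ seqOp A B C with hE
  suffices h : E ψ = 0 by
    simpa [hE, sub_eq_zero] using h
  have hEφ : ∀ a, E (φ a) = 0 := fun a => by
    simp [hE, casoratiOp_self, hφ]
  obtain ⟨c, hc⟩ := exists_interpolation (hW 0) ψ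
  set η : ℤ → K := ψ - ∑ a, c a • φ a with hη
  have hη0 : ∀ i < n + 1, η (i : ℤ) = 0 := fun i hi => by
    have := hc i hi
    rw [zero_add] at this
    rw [hη, Pi.sub_apply, sub_eq_zero, this]
  have hEη : E ψ = E η := by
    rw [hη, map_sub, map_sum]
    simp [hEφ]
  have h1 : casoratiOp φ 1 η = (-1) ^ n * W' 1 * η (n + 1 : ℕ) +
      (-1) ^ (n + 1) * casorati φ 1 * η (n + 2 : ℕ) := by
    rw [casoratiOp_apply, Finset.sum_range_succ, Finset.sum_range_succ, Finset.sum_eq_zero,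
      zero_add, hM, casoratiMinor_last]
    · congr 3 <;> (push_cast; ring)
    · intro j hj
      have := hη0 (j + 1) (by simpa using hj)
      push_cast at this
      rw [add_comm 1, this, mul_zero]
  have h0 : casoratiOp φ 0 η = (-1) ^ (n + 1) * casorati φ 0 * η (n + 1 : ℕ) := by
    rw [casoratiOp_apply, Finset.sum_range_succ, Finset.sum_eq_zero, zero_add,
      casoratiMinor_last, zero_add]
    intro j hj
    rw [zero_add, hη0 j (by simpa using hj), mul_zero]
  have hm1 : casoratiOp φ (-1) η = casorati φ 0 * η (-1) := by
    rw [casoratiOp_apply, Finset.sum_range_succ', Finset.sum_eq_zero, zero_add,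
      casoratiMinor_zero]
    · simp
    · intro j hj
      have := hη0 j (by simpa using hj)
      push_cast
      rw [neg_add_cancel_comm_assoc, this, mul_zero]
  have hD : casoratiOp φ 0 (seqOp A B C η) =
      (-1) ^ n * W' 0 * (A n * η (n + 1 : ℕ)) +
      (-1) ^ (n + 1) * casorati φ 0 * (A (n + 1 : ℕ) * η (n + 2 : ℕ)) +
      (-1) ^ (n + 1) * casorati φ 0 * (B (n + 1 : ℕ) * η (n + 1 : ℕ)) +
      casorati φ 1 * (C 0 * η (-1)) := by
    rw [casoratiOp_apply]
    simp only [seqOp_apply, mul_add, zero_add, Finset.sum_add_distrib]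
    congr 1
    congr 1
    · rw [Finset.sum_range_succ, Finset.sum_range_succ, Finset.sum_eq_zero, zero_add, hM,
        casoratiMinor_last]
      · congr 4
      · intro j hj
        have := hη0 (j + 1) (by simpa using hj)
        push_cast at this
        rw [this, mul_zero, mul_zero]
    · rw [Finset.sum_range_succ, Finset.sum_eq_zero, zero_add, casoratiMinor_last]
      intro j hj
      rw [hη0 j (by simpa using hj), mul_zero, mul_zero]
    · rw [Finset.sum_range_succ', Finset.sum_eq_zero, zero_add, casoratiMinor_zero]
      · simp
      · intro j hj
        have := hη0 j (by simpa using hj)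
        push_cast
        rw [add_sub_cancel_right, this, mul_zero, mul_zero]
  rw [hEη, hE]
  simp only [LinearMap.sub_apply, LinearMap.add_apply, LinearMap.smul_apply,
    LinearMap.comp_apply, smul_eq_mul]
  rw [h1, h0, hm1, hD]
  have e : ((n + 1 : ℕ) : ℤ) - 1 = n := by push_cast; ring
  rw [e]
  have := hW 0
  have := hW 1
  field_simp
  ring

end Casorati

open Polynomial

/-! ### Hahn polynomials as eigenfunctions of a difference operator. -/

section Hahn

lemma poch_succ (a : ℝ) (j : ℕ) : poch a (j + 1) = poch a j * (a + j) := by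
  simp [poch, ascPochhammer_succ_eval]

lemma poch_succ_left (a : ℝ) (j : ℕ) : poch a (j + 1) = a * poch (a + 1) j := by
  simp [poch, ascPochhammer_succ_left]

lemma poch_ne_zero {a : ℝ} {j : ℕ} (h : ∀ i < j, a + (i : ℝ) ≠ 0) : poch a j ≠ 0 := by
  induction j with
  | zero => simp [poch]
  | succ j ih =>
    rw [poch_succ]
    exact mul_ne_zero (ih fun i hi => h i (by omega)) (h j (by omega))

@[simp] lemma sPoly_zero (u : ℝ) : sPoly u 0 = 1 := by simp [sPoly]

lemma sPoly_succ (u : ℝ) (j : ℕ) : sPoly u (j + 1) = sPoly u j * (C (u + j) - X) := by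
  simp only [sPoly, ascPochhammer_succ_right, mul_comp, add_comp, X_comp, natCast_comp, C_add]
  congr 1
  simp only [map_natCast]
  ring

lemma polyShift_sPoly (c u : ℝ) (j : ℕ) : polyShift c (sPoly u j) = sPoly (u - c) j := by
  simp only [polyShift, sPoly, comp_assoc]
  congr 1
  simp only [sub_comp, C_comp, X_comp, C_sub]
  ring

lemma sPoly_succ_left (u : ℝ) (j : ℕ) : sPoly u (j + 1) = (C u - X) * sPoly (u + 1) j := by
  simp only [sPoly, ascPochhammer_succ_left, mul_comp, X_comp, comp_assoc]
  congr 2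
  simp only [add_comp, X_comp, one_comp, C_add, C_1]
  ring

lemma sPoly_add (u : ℝ) (a b : ℕ) : sPoly u (a + b) = sPoly u a * sPoly (u + a) b := by
  induction b with
  | zero => simp
  | succ b ih => rw [← add_assoc, sPoly_succ, ih, sPoly_succ, mul_assoc]; push_cast; ring_nf

lemma C_sub_X_ne_zero (c : ℝ) : (C c - X : ℝ[X]) ≠ 0 := by
  rw [← neg_sub, neg_ne_zero]
  exact X_sub_C_ne_zero c

lemma sPoly_ne_zero (u : ℝ) (j : ℕ) : sPoly u j ≠ 0 := by
  induction j with
  | zero => simp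
  | succ j ih => rw [sPoly_succ]; exact mul_ne_zero ih (C_sub_X_ne_zero _)

lemma natDegree_sPoly (u : ℝ) (j : ℕ) : (sPoly u j).natDegree = j := by
  induction j with
  | zero => simp
  | succ j ih =>
    rw [sPoly_succ, natDegree_mul (sPoly_ne_zero _ _) (C_sub_X_ne_zero _), ih, natDegree_sub,
      natDegree_X_sub_C]

/-- The second order difference operator of the Hahn polynomials. -/
def hahnOp (α β N : ℝ) : ℝ[X] →ₗ[ℝ] ℝ[X] where
  toFun p := (X + C (α + 1)) * (X - C N) * (polyShift 1 p - p) +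
    X * (X - C (β + N + 1)) * (polyShift (-1) p - p)
  map_add' p q := by simp only [polyShift, add_comp]; ring
  map_smul' c p := by simp only [polyShift, smul_eq_C_mul, mul_comp, C_comp, RingHom.id_apply]; ring

/-- The Hahn operator is bidiagonal in the basis `(-x)_j`, so its eigenvalue equation is a first
order recurrence for the coefficients. -/
lemma hahnOp_sPoly (α β N : ℝ) (j : ℕ) : hahnOp α β N (sPoly 0 j) =
    C (j * (j + α + β + 1)) * sPoly 0 j -
      C (j * (j - 1 - N) * (j + α)) * sPoly 0 (j - 1) := by
  simp only [hahnOp, LinearMap.coe_mk, AddHom.coe_mk, polyShift_sPoly]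
  rcases j with _ | i
  · simp
  · have h1 : sPoly (0 - 1) (i + 1) = (C (0 - 1) - X) * sPoly 0 i := by
      rw [sPoly_succ_left, sub_add_cancel]
    have h2 : sPoly 0 (i + 1) = sPoly 0 i * (C (0 + (i : ℝ)) - X) := sPoly_succ 0 i
    have h3 : sPoly 0 (i + 1) = (C 0 - X) * sPoly 1 i := by
      rw [sPoly_succ_left, zero_add]
    have h4 : sPoly (0 - -1) (i + 1) = sPoly 1 i * (C (1 + (i : ℝ)) - X) := by
      rw [sub_neg_eq_add, zero_add, sPoly_succ]
    have h5 : X * (sPoly (0 - -1) (i + 1) - sPoly 0 (i + 1)) =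
        - C ((i : ℝ) + 1) * sPoly 0 (i + 1) := by
      rw [h4]
      nth_rewrite 1 [h3]
      rw [h3]
      simp only [C_add, C_1, C_0]
      ring
    rw [mul_right_comm X, h5, h1, h2, Nat.add_sub_cancel]
    push_cast
    simp only [C_add, C_1, C_0, C_sub, C_mul]
    ring

lemma hahnOp_hahn {α : ℝ} (β N : ℝ) (hα : ∀ m : ℕ, α ≠ -((m : ℝ) + 1)) (n : ℕ) :
    hahnOp α β N (hahn α β N n) = C (lam α β n) * hahn α β N n := by
  have hα' : ∀ m : ℕ, α + 1 + m ≠ 0 := fun m h => hα m (by linarith)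
  set c : ℕ → ℝ := fun j =>
    poch (-(n : ℝ)) j * poch ((n : ℝ) + α + β + 1) j * poch (-N + (j : ℝ)) (n - j) /
        (poch (α + 1) j * (j.factorial : ℝ)) with hc
  have hh : hahn α β N n = ∑ j ∈ Finset.range (n + 1), c j • sPoly 0 j := by
    simp only [hahn, hc, smul_eq_C_mul]
  -- The factor on the right is `λ(j) - λ(n)`: this compares the coefficients of `(-x)_j`.
  have hrec : ∀ j < n, c (j + 1) * (((j + 1 : ℕ) : ℝ) * ((j + 1 : ℕ) - 1 - N) * ((j + 1 : ℕ) + α)) =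
      c j * (((j : ℝ) - n) * (j + n + α + β + 1)) := by
    intro j hj
    have hp : poch (α + 1) j ≠ 0 := poch_ne_zero fun i _ => hα' i
    have hf : (j.factorial : ℝ) ≠ 0 := by positivity
    have hj1 : (j : ℝ) + 1 ≠ 0 := by positivity
    have ha := hα' j
    obtain ⟨d, rfl⟩ : ∃ d, n = j + 1 + d := ⟨n - (j + 1), by omega⟩
    have e1 : j + 1 + d - (j + 1) = d := by omega
    have e2 : j + 1 + d - j = d + 1 := by omega
    simp only [hc, e1, e2, poch_succ _ j, poch_succ_left (-N + (j : ℝ)) d, Nat.factorial_succ]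
    push_cast
    rw [← add_assoc (-N)]
    field_simp
    ring
  rw [hh, map_sum, Finset.mul_sum]
  simp only [map_smul, hahnOp_sPoly, smul_sub, Finset.sum_sub_distrib]
  rw [Finset.sum_range_succ, Finset.sum_range_succ' (fun j => c j •
    (C ((j : ℝ) * (j - 1 - N) * (j + α)) * sPoly 0 (j - 1))), Finset.sum_range_succ]
  simp only [Nat.cast_zero, zero_mul, C_0, smul_zero, add_zero, Nat.add_sub_cancel]
  rw [add_sub_right_comm, ← Finset.sum_sub_distrib]
  congr 1
  · refine Finset.sum_congr rfl fun j hj => ?_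
    have := congrArg C (hrec j (Finset.mem_range.mp hj))
    simp only [smul_eq_C_mul, lam]
    rw [C_mul] at this
    rw [← mul_assoc (C (c (j + 1))), this]
    simp only [C_add, C_1, C_sub, C_mul]
    ring
  · simp only [smul_eq_C_mul, lam]
    ring

/-- Only `j = n` contributes to the coefficient of `x^n`. The factor `(n+α+β+1)_n` there is what
needs the condition on `α + β`. -/
lemma hahn_ne_zero {α β : ℝ} (N : ℝ) (hα : ∀ m : ℕ, α ≠ -((m : ℝ) + 1))
    (hαβ : ∀ m : ℕ, α + β ≠ -((m : ℝ) + 1)) (n : ℕ) : hahn α β N n ≠ 0 := by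
  intro h
  have h1 := congrArg (fun p : ℝ[X] => p.coeff n) h
  simp only [hahn, finsetSum_coeff, coeff_C_mul, coeff_zero] at h1
  rw [Finset.sum_range_succ, Finset.sum_eq_zero, zero_add] at h1
  · have hl : (sPoly 0 n).coeff n ≠ 0 := by
      have := leadingCoeff_ne_zero.mpr (sPoly_ne_zero 0 n)
      rwa [leadingCoeff, natDegree_sPoly] at this
    refine mul_ne_zero (div_ne_zero (mul_ne_zero (mul_ne_zero ?_ ?_) ?_) (mul_ne_zero ?_ ?_)) hl h1
    · refine poch_ne_zero fun i hi h0 => ?_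
      have : (i : ℝ) < n := by exact_mod_cast hi
      linarith
    · refine poch_ne_zero fun i _ h0 => hαβ (n + i) ?_
      push_cast
      linarith
    · simp [poch]
    · exact poch_ne_zero fun i _ h0 => hα i (by linarith)
    · positivity
  · intro j hj
    rw [coeff_eq_zero_of_natDegree_lt, mul_zero]
    rw [natDegree_sPoly]
    exact Finset.mem_range.mp hj

end Hahn

/-! ### Shifts of rational functions and twisted sequences. -/

section Shift

lemma Sh_algebraMap (l : ℤ) (p : ℝ[X]) :
    Sh l (algebraMap ℝ[X] (RatFunc ℝ) p) = algebraMap ℝ[X] (RatFunc ℝ) (polyShift l p) := by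
  rw [Sh, IsFractionRing.algEquivOfAlgEquiv_algebraMap]
  simp [polyShift, algEquivAevalXAddC, comp_eq_aeval]

lemma Sh_C (l : ℤ) (c : ℝ) : Sh l (RatFunc.C c) = RatFunc.C c := by
  rw [← RatFunc.algebraMap_C, Sh_algebraMap]
  simp [polyShift]

lemma Sh_X (l : ℤ) : Sh l RatFunc.X = RatFunc.X + RatFunc.C (l : ℝ) := by
  rw [← RatFunc.algebraMap_X, Sh_algebraMap, ← RatFunc.algebraMap_C, ← map_add]
  simp [polyShift]

lemma Sh_Sh (l m : ℤ) (f : RatFunc ℝ) : Sh l (Sh m f) = Sh (m + l) f := by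
  obtain ⟨p, q, -, rfl⟩ := IsFractionRing.div_surjective (A := ℝ[X]) f
  simp only [map_div₀, Sh_algebraMap, polyShift, comp_assoc]
  congr 3 <;> simp [add_assoc, add_left_comm, add_comm]

lemma Sh_zero (f : RatFunc ℝ) : Sh 0 f = f := by
  obtain ⟨p, q, -, rfl⟩ := IsFractionRing.div_surjective (A := ℝ[X]) f
  simp [Sh_algebraMap, polyShift]

/-- The shift by one as a ring automorphism. -/
def shiftOne : RatFunc ℝ ≃+* RatFunc ℝ := (Sh 1).toRingEquiv

lemma shiftOne_apply (f : RatFunc ℝ) : shiftOne f = Sh 1 f := rfl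

/-- The sequence `φ` with `φ 0 = p` and `φ (m + 1) = ρ * Sh 1 (φ m)`. -/
def twistSeq {ρ : RatFunc ℝ} (hρ : ρ ≠ 0) (p : RatFunc ℝ) (m : ℤ) : RatFunc ℝ :=
  ((shiftOne.toEquiv.trans (Equiv.mulLeft₀ ρ hρ) : Equiv.Perm (RatFunc ℝ)) ^ m) p

variable {ρ : RatFunc ℝ} (hρ : ρ ≠ 0) (p : RatFunc ℝ)

lemma twistSeq_zero : twistSeq hρ p 0 = p := by simp [twistSeq]

lemma twistSeq_succ (m : ℤ) : twistSeq hρ p (m + 1) = ρ * shiftOne (twistSeq hρ p m) := by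
  rw [twistSeq, add_comm, zpow_one_add]
  rfl

lemma twistSeq_neg_one : twistSeq hρ p (-1) = Sh (-1) p / Sh (-1) ρ := by
  have h := twistSeq_succ hρ p (-1)
  rw [neg_add_cancel, twistSeq_zero, shiftOne_apply] at h
  have h' := congrArg (Sh (-1)) h
  rw [map_mul, Sh_Sh, add_neg_cancel, Sh_zero] at h'
  rw [h', mul_div_cancel_left₀]
  simpa using hρ

end Shift

/-! ### The normalizing products, and polynomiality of the determinant quotient. -/

section Divisibility

/-- The `j`-th smallest element of `s`, counted from `0`, is at least `j`. -/
lemma prod_range_card_dvd {R : Type*} [CommMonoid R] {f : ℕ → R} (hf : ∀ i, f i ∣ f (i + 1))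
    (s : Finset ℕ) : ∏ j ∈ Finset.range s.card, f j ∣ ∏ i ∈ s, f i := by
  have hmono : ∀ i j, i ≤ j → f i ∣ f j := fun i j h => by
    induction j, h using Nat.le_induction with
    | base => exact dvd_rfl
    | succ j _ ih => exact ih.trans (hf j)
  induction s using Finset.induction_on_max with
  | empty => simp
  | insert a s ha ih =>
    have hna : a ∉ s := fun h => lt_irrefl _ (ha a h)
    rw [Finset.card_insert_of_notMem hna, Finset.prod_range_succ, Finset.prod_insert hna, mul_comm]
    refine mul_dvd_mul (hmono _ _ ?_) ih
    have : s ⊆ Finset.range a := fun x hx => Finset.mem_range.mpr (ha x hx)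
    simpa using Finset.card_le_card this

lemma prod_range_dvd_of_injective {R : Type*} [CommMonoid R] {f : ℕ → R}
    (hf : ∀ i, f i ∣ f (i + 1)) {n : ℕ} {i : Fin n → ℕ} (hi : Function.Injective i) :
    ∏ j ∈ Finset.range n, f j ∣ ∏ b, f (i b) := by
  have := prod_range_card_dvd hf (Finset.univ.image i)
  rwa [Finset.card_image_of_injective _ hi, Finset.card_fin,
    Finset.prod_image hi.injOn] at this

lemma prod_Icc_one_eq_range {R : Type*} [CommMonoid R] (f : ℕ → R) (n : ℕ) :
    ∏ i ∈ Finset.Icc 1 n, f i = ∏ j ∈ Finset.range n, f (j + 1) := by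
  rw [Finset.range_eq_Ico, Finset.prod_Ico_add' f 0 n 1]
  rfl

lemma denH_eq (β N : ℝ) (k k₂ : ℕ) : denH β N k k₂ =
    (∏ j ∈ Finset.range k₂, sPoly (N - k + 1) j) *
      ∏ j ∈ Finset.range k₂, sPoly (N + β + 1 - j) j := by
  rw [denH, Finset.prod_mul_distrib, prod_Icc_one_eq_range, prod_Icc_one_eq_range]
  congr 1
  · rw [← Finset.prod_range_reflect]
    exact Finset.prod_congr rfl fun j hj => by congr 1; have := Finset.mem_range.mp hj; omega
  · refine Finset.prod_congr rfl fun j _ => ?_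
    rw [Nat.add_sub_cancel]
    congr 1
    push_cast
    ring

lemma denΩ_eq (β N : ℝ) (k k₂ : ℕ) : denΩ β N k k₂ =
    (∏ j ∈ Finset.range k₂, sPoly (N - k + 1) (j + 1)) *
      ∏ j ∈ Finset.range k₂, sPoly (N + β + 1 - j) j := by
  rw [denΩ, Finset.prod_mul_distrib, prod_Icc_one_eq_range, prod_Icc_one_eq_range]
  congr 1
  · rw [← Finset.prod_range_reflect]
    exact Finset.prod_congr rfl fun j hj => by congr 1; have := Finset.mem_range.mp hj; omega
  · refine Finset.prod_congr rfl fun j _ => ?_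
    rw [Nat.add_sub_cancel]
    congr 1
    push_cast
    ring

lemma denH_ne_zero (β N : ℝ) (k k₂ : ℕ) : denH β N k k₂ ≠ 0 :=
  Finset.prod_ne_zero_iff.mpr fun _ _ => mul_ne_zero (sPoly_ne_zero _ _) (sPoly_ne_zero _ _)

lemma denΩ_ne_zero (β N : ℝ) (k k₂ : ℕ) : denΩ β N k k₂ ≠ 0 :=
  Finset.prod_ne_zero_iff.mpr fun _ _ => mul_ne_zero (sPoly_ne_zero _ _) (sPoly_ne_zero _ _)

lemma denΩ_eq_mul_denH (β N : ℝ) (k k₂ : ℕ) :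
    denΩ β N k k₂ = sPoly (N - k + 1) k₂ * denH β N k k₂ := by
  rw [denΩ_eq, denH_eq, ← mul_assoc]
  congr 1
  have h := Finset.prod_range_succ (fun j => sPoly (N - k + 1) j) k₂
  rw [Finset.prod_range_succ', sPoly_zero, mul_one] at h
  rw [h, mul_comm]

/-- In each Leibniz term the `F₂` rows use distinct columns `i_b`, contributing `(N-k+1-x)_{k-i_b}`
and `(N+β+1-i_b-x)_{i_b}`. Both families are chains for divisibility, so distinct indices give a
multiple of the product over `0, …, k₂-1`. -/
lemma denH_dvd_det (α β N : ℝ) (F₁ F₂ : Finset ℕ) (r : ℕ → ℝ[X]) :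
    denH β N (F₁.card + F₂.card) F₂.card ∣
      Matrix.det (Matrix.of fun a i : Fin (F₁.card + F₂.card + 1) =>
        (Fin.cons r (rows α β N F₁ F₂) :
          Fin (F₁.card + F₂.card + 1) → ℕ → ℝ[X]) a i) := by
  rw [← Matrix.det_transpose, Matrix.det_apply']
  refine Finset.dvd_sum fun π _ => Dvd.dvd.mul_left ?_ _
  rw [Fin.prod_univ_succ, Fin.prod_univ_add]
  refine Dvd.dvd.mul_left (Dvd.dvd.mul_left ?_ _) _
  set i : Fin F₂.card → ℕ := fun b => (π (Fin.natAdd F₁.card b).succ : ℕ)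
  have hi : Function.Injective i := fun b b' h => by
    simpa [i, Fin.val_inj] using h
  have hik : ∀ b, i b ≤ F₁.card + F₂.card := fun b => Nat.lt_succ_iff.mp (Fin.is_lt _)
  have h1 := prod_range_dvd_of_injective (f := sPoly (N - (F₁.card + F₂.card : ℕ) + 1))
    (fun j => by rw [sPoly_succ]; exact dvd_mul_right _ _)
    (i := fun b => F₁.card + F₂.card - i b) (fun b b' h => hi (by
      have := hik b
      have := hik b'
      simp only at h
      omega))
  have h2 := prod_range_dvd_of_injective (f := fun j => sPoly (N + β + 1 - j) j)
    (fun j => by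
      rw [sPoly_succ_left]
      push_cast
      rw [← sub_sub, sub_add_cancel]
      exact dvd_mul_left _ _) hi
  rw [denH_eq]
  refine (mul_dvd_mul h1 h2).trans ?_
  rw [← Finset.prod_mul_distrib]
  refine Finset.prod_dvd_prod_of_dvd _ _ fun b _ => ?_
  simp only [Matrix.transpose_apply, Matrix.of_apply, Fin.cons_succ, rows, Fin.append_right,
    entry₂, polyShift_sPoly]
  exact dvd_mul_right _ _

end Divisibility

/-! ### Calculus of the linear factors and Pochhammer products. -/

section Factors

/-- The rational function `c - x`. -/
def lin (c : ℝ) : RatFunc ℝ := RatFunc.C c - RatFunc.X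

/-- The rational function `(u - x)_j`. -/
def sRat (u : ℝ) (j : ℕ) : RatFunc ℝ := algebraMap ℝ[X] (RatFunc ℝ) (sPoly u j)

lemma lin_eq (c : ℝ) : lin c = algebraMap ℝ[X] (RatFunc ℝ) (C c - X) := by
  rw [lin, map_sub, RatFunc.algebraMap_C, RatFunc.algebraMap_X]

lemma lin_ne_zero (c : ℝ) : lin c ≠ 0 := by
  rw [lin_eq]
  exact RatFunc.algebraMap_ne_zero (C_sub_X_ne_zero c)

lemma Sh_lin (l : ℤ) (c : ℝ) : Sh l (lin c) = lin (c - l) := by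
  rw [lin, map_sub, Sh_C, Sh_X, lin, map_sub]
  ring

lemma X_add_C_eq (c : ℝ) : RatFunc.X + RatFunc.C c = -lin (-c) := by
  rw [lin, map_neg]
  ring

lemma sRat_ne_zero (u : ℝ) (j : ℕ) : sRat u j ≠ 0 :=
  RatFunc.algebraMap_ne_zero (sPoly_ne_zero u j)

lemma Sh_sRat (l : ℤ) (u : ℝ) (j : ℕ) : Sh l (sRat u j) = sRat (u - l) j := by
  rw [sRat, Sh_algebraMap, polyShift_sPoly, sRat]

lemma sRat_succ (u : ℝ) (j : ℕ) : sRat u (j + 1) = sRat u j * lin (u + j) := by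
  rw [sRat, sPoly_succ, map_mul, lin_eq, sRat]

lemma sRat_succ_left (u : ℝ) (j : ℕ) : sRat u (j + 1) = lin u * sRat (u + 1) j := by
  rw [sRat, sPoly_succ_left, map_mul, lin_eq, sRat]

lemma sRat_sub_one (u : ℝ) (j : ℕ) : sRat (u - 1) j * lin (u - 1 + j) = lin (u - 1) * sRat u j := by
  rw [← sRat_succ, sRat_succ_left, sub_add_cancel]

/-- The two shifted quotients of the products `∏ (κ - x)_{j+1}` and `∏ (κ - x)_j`, together with
`∏ (c - j - x)_j`, which occur in the lowest coefficient. -/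
lemma factor_quotient (κ c : ℝ) (n : ℕ) :
    (∏ j ∈ Finset.range n, sRat κ (j + 1)) * (∏ j ∈ Finset.range n, sRat (c - j) j) *
      ((∏ j ∈ Finset.range n, sRat κ j) * (∏ j ∈ Finset.range n, sRat (c - j) j)) *
      (lin (κ - 1) * lin c) ^ n * lin (c - n) =
    Sh 1 ((∏ j ∈ Finset.range n, sRat κ (j + 1)) * (∏ j ∈ Finset.range n, sRat (c - j) j)) *
      Sh (-1) ((∏ j ∈ Finset.range n, sRat κ j) * (∏ j ∈ Finset.range n, sRat (c - j) j)) *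
      (lin κ * lin (c - 1)) ^ n * lin c := by
  simp only [map_mul, map_prod, Sh_sRat]
  induction n with
  | zero => simp
  | succ n ih =>
    simp only [Finset.prod_range_succ]
    have e1 : sRat (κ - (1 : ℤ)) (n + 1) = lin (κ - 1) * sRat κ n := by
      rw [Int.cast_one, sRat_succ_left, sub_add_cancel]
    have e2 : sRat κ (n + 1) = lin κ * sRat (κ - (-1 : ℤ)) n := by
      rw [sRat_succ_left]
      push_cast
      rw [sub_neg_eq_add]
    have e3 : lin (c - (n + 1 : ℕ)) * sRat (c - n) n = sRat (c - n - (1 : ℤ)) n * lin (c - 1) := by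
      have h1 := sRat_succ_left (c - n - 1) n
      have h2 := sRat_succ (c - n - 1) n
      rw [sub_add_cancel] at h1
      rw [show c - n - 1 + (n : ℝ) = c - 1 by ring] at h2
      push_cast
      rw [← sub_sub, ← h1, h2]
    have e4 : lin (c - n) * sRat (c - n - (-1 : ℤ)) n = sRat (c - n) n * lin c := by
      have h1 := sRat_succ_left (c - n) n
      have h2 := sRat_succ (c - n) n
      rw [sub_add_cancel] at h2
      push_cast
      rw [sub_neg_eq_add, ← h1, h2]
    have key : sRat κ (n + 1) * sRat (c - n) n * sRat (c - n) n * lin c * lin (c - (n + 1 : ℕ)) =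
        lin κ * sRat (κ - (-1 : ℤ)) n * (sRat (c - n - (1 : ℤ)) n * lin (c - 1)) *
          (lin (c - n) * sRat (c - n - (-1 : ℤ)) n) := by
      rw [e2, ← e3, e4]
      ring
    rw [e1]
    -- The factor `lin (c - n)` closes the induction: it is the last factor on the left of `ih`, and
    -- `e4` absorbs it on the right.
    refine mul_right_cancel₀ (lin_ne_zero (c - n)) ?_
    generalize (∏ j ∈ Finset.range n, sRat κ (j + 1)) = p₁ at *
    generalize (∏ j ∈ Finset.range n, sRat (c - j) j) = p₂ at *
    generalize (∏ j ∈ Finset.range n, sRat κ j) = p₃ at *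
    generalize (∏ j ∈ Finset.range n, sRat (κ - (1 : ℤ)) (j + 1)) = p₄ at *
    generalize (∏ j ∈ Finset.range n, sRat (c - j - (1 : ℤ)) j) = p₅ at *
    generalize (∏ j ∈ Finset.range n, sRat (κ - (-1 : ℤ)) j) = p₆ at *
    generalize (∏ j ∈ Finset.range n, sRat (c - j - (-1 : ℤ)) j) = p₇ at *
    linear_combination (sRat κ (n + 1) * sRat (c - n) n * sRat κ n * sRat (c - n) n *
      lin (κ - 1) * lin c * lin (c - (n + 1 : ℕ))) * ih +
      (p₄ * p₅ * (p₆ * p₇) * (lin κ * lin (c - 1)) ^ n * lin c * lin (κ - 1) * sRat κ n) * key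

end Factors

/-! ### The seed sequences, their eigenvalues and the rows of the determinants. -/

section Seeds

/-- The coefficient `(x+m+α+1)(x+m-N)` of `Sh_1` in the Hahn operator. -/
def hahnA (α N : ℝ) (m : ℤ) : RatFunc ℝ := lin (-α - 1 - m) * lin (N - m)

/-- The coefficient `(x+m)(x+m-β-N-1)` of `Sh_{-1}` in the Hahn operator. -/
def hahnC (β N : ℝ) (m : ℤ) : RatFunc ℝ := lin (-m) * lin (β + N + 1 - m)

/-- The coefficient of `Sh_0` in the Hahn operator. -/
def hahnB (α β N : ℝ) (m : ℤ) : RatFunc ℝ := -(hahnA α N m + hahnC β N m)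

lemma hahnA_succ (α N : ℝ) (m : ℤ) : hahnA α N (m + 1) = shiftOne (hahnA α N m) := by
  rw [shiftOne_apply, hahnA, hahnA, map_mul, Sh_lin, Sh_lin]
  congr 2 <;> (push_cast; ring)

lemma hahnC_succ (β N : ℝ) (m : ℤ) : hahnC β N (m + 1) = shiftOne (hahnC β N m) := by
  rw [shiftOne_apply, hahnC, hahnC, map_mul, Sh_lin, Sh_lin]
  push_cast
  rw [neg_add', sub_sub]

lemma hahnB_succ (α β N : ℝ) (m : ℤ) : hahnB α β N (m + 1) = shiftOne (hahnB α β N m) := by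
  rw [hahnB, hahnB, map_neg, map_add, hahnA_succ, hahnC_succ]

/-- The Hahn polynomial as a rational function. -/
def hahnRat (α β N : ℝ) (n : ℕ) : RatFunc ℝ := algebraMap ℝ[X] (RatFunc ℝ) (hahn α β N n)

lemma hahnRat_eigen {α : ℝ} (β N : ℝ) (hα : ∀ m : ℕ, α ≠ -((m : ℝ) + 1)) (n : ℕ) :
    hahnA α N 0 * Sh 1 (hahnRat α β N n) + hahnB α β N 0 * hahnRat α β N n +
      hahnC β N 0 * Sh (-1) (hahnRat α β N n) =
    RatFunc.C (lam α β n) * hahnRat α β N n := by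
  have h := congrArg (algebraMap ℝ[X] (RatFunc ℝ)) (hahnOp_hahn β N hα n)
  simp only [hahnOp, LinearMap.coe_mk, AddHom.coe_mk, map_add, map_mul, map_sub,
    RatFunc.algebraMap_C, RatFunc.algebraMap_X] at h
  rw [hahnRat, Sh_algebraMap, Sh_algebraMap, ← h, hahnB, hahnA, hahnC]
  simp only [lin, Int.cast_zero, Int.cast_one, Int.cast_neg, sub_zero, neg_zero, map_sub, map_neg,
    map_add, map_zero]
  ring

lemma hahnRat_ne_zero {α β : ℝ} (N : ℝ) (hα : ∀ m : ℕ, α ≠ -((m : ℝ) + 1))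
    (hαβ : ∀ m : ℕ, α + β ≠ -((m : ℝ) + 1)) (n : ℕ) : hahnRat α β N n ≠ 0 :=
  RatFunc.algebraMap_ne_zero (hahn_ne_zero N hα hαβ n)

/-- The quotient `w(x+1)/w(x)` of the weight which conjugates the Hahn operator with parameters
`α, -β, β + N` to the one with parameters `α, β, N`. -/
def weightRatio (β N : ℝ) : RatFunc ℝ := lin (N + β) / lin N

lemma weightRatio_ne_zero (β N : ℝ) : weightRatio β N ≠ 0 :=
  div_ne_zero (lin_ne_zero _) (lin_ne_zero _)

/-- The sequence `h_n^{α,β,N}(x + m)`. -/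
def seed₁ (α β N : ℝ) (n : ℕ) : ℤ → RatFunc ℝ := twistSeq one_ne_zero (hahnRat α β N n)

/-- The sequence `w(x + m) h_n^{α,-β,β+N}(x + m) / w(x)`. -/
def seed₂ (α β N : ℝ) (n : ℕ) : ℤ → RatFunc ℝ :=
  twistSeq (weightRatio_ne_zero β N) (hahnRat α (-β) (β + N) n)

lemma seqOp_seed₁ {α : ℝ} (β N : ℝ) (hα : ∀ m : ℕ, α ≠ -((m : ℝ) + 1)) (n : ℕ) :
    seqOp (hahnA α N) (hahnB α β N) (hahnC β N) (seed₁ α β N n) =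
      RatFunc.C (lam α β n) • seed₁ α β N n := by
  refine seqOp_eigen (hahnA_succ α N) (hahnB_succ α β N) (hahnC_succ β N) one_ne_zero
    (twistSeq_succ _ _) (Sh_C 1 _) ?_
  have h1 := twistSeq_succ one_ne_zero (hahnRat α β N n) 0
  rw [zero_add, twistSeq_zero, one_mul, shiftOne_apply] at h1
  rw [seed₁, h1, twistSeq_zero, twistSeq_neg_one, map_one, div_one]
  exact hahnRat_eigen β N hα n

lemma seqOp_seed₂ {α : ℝ} (β N : ℝ) (hα : ∀ m : ℕ, α ≠ -((m : ℝ) + 1)) (n : ℕ) :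
    seqOp (hahnA α N) (hahnB α β N) (hahnC β N) (seed₂ α β N n) =
      RatFunc.C (lam α β (n - β)) • seed₂ α β N n := by
  refine seqOp_eigen (hahnA_succ α N) (hahnB_succ α β N) (hahnC_succ β N)
    (weightRatio_ne_zero β N) (twistSeq_succ _ _) (Sh_C 1 _) ?_
  have h1 := twistSeq_succ (weightRatio_ne_zero β N) (hahnRat α (-β) (β + N) n) 0
  rw [zero_add, twistSeq_zero, shiftOne_apply] at h1
  rw [seed₂, h1, twistSeq_zero, twistSeq_neg_one]
  have h := hahnRat_eigen (-β) (β + N) hα n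
  generalize hahnRat α (-β) (β + N) n = H at *
  have hA : hahnA α N 0 * weightRatio β N = hahnA α (β + N) 0 := by
    have := lin_ne_zero N
    simp only [hahnA, weightRatio, Int.cast_zero, sub_zero]
    rw [add_comm N β]
    field_simp
  have hC : hahnC β N 0 / Sh (-1) (weightRatio β N) = hahnC (-β) (β + N) 0 := by
    have h2 := lin_ne_zero (N + 1)
    have h3 := lin_ne_zero (β + N + 1)
    simp only [hahnC, weightRatio, map_div₀, Sh_lin, Int.cast_zero, sub_zero, Int.cast_neg,
      Int.cast_one, sub_neg_eq_add]
    rw [add_comm N β, neg_add_cancel_left]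
    field_simp
  -- After conjugation by the weight the two operators differ by the constant `-β(α+1)`, which moves
  -- the eigenvalue to `λ(n-β)`.
  have hB : hahnB α β N 0 = hahnB α (-β) (β + N) 0 +
      (RatFunc.C (lam α β (n - β)) - RatFunc.C (lam α (-β) n)) := by
    simp only [hahnB, hahnA, hahnC, lam, lin, Int.cast_zero, sub_zero, map_sub, map_add, map_mul,
      map_neg, map_one, map_natCast, neg_zero, map_zero]
    ring
  rw [← mul_assoc, hA, hB, mul_div_assoc', mul_div_right_comm, hC]
  linear_combination h

lemma seed₁_natCast (α β N : ℝ) (n i : ℕ) :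
    seed₁ α β N n i = algebraMap ℝ[X] (RatFunc ℝ) (entry₁ α β N n i) := by
  have : ∀ i : ℕ, seed₁ α β N n i = Sh i (hahnRat α β N n) := fun i => by
    induction i with
    | zero => rw [seed₁, Nat.cast_zero, twistSeq_zero, Sh_zero]
    | succ i ih =>
      rw [Nat.cast_succ, seed₁, twistSeq_succ, one_mul, ← seed₁, ih, shiftOne_apply, Sh_Sh]
  rw [this, hahnRat, Sh_algebraMap, entry₁, Int.cast_natCast]

lemma seed₂_natCast (α β N : ℝ) (n : ℕ) {k i : ℕ} (hi : i ≤ k) :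
    sRat (N - k + 1) k * seed₂ α β N n i =
      algebraMap ℝ[X] (RatFunc ℝ) (entry₂ α β N k n i) := by
  -- Iterating the weight ratio gives `w(x+i)/w(x) = (N+β+1-i-x)_i / (N+1-i-x)_i`; the denominator
  -- is the upper part of `(N-k+1-x)_k`.
  have h : ∀ i : ℕ, sRat (N + 1 - i) i * seed₂ α β N n i =
      sRat (N + β + 1 - i) i * Sh i (hahnRat α (-β) (β + N) n) := fun i => by
    induction i with
    | zero => rw [seed₂, Nat.cast_zero, Nat.cast_zero, twistSeq_zero, Sh_zero]; simp [sRat]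
    | succ i ih =>
      have ih' := congrArg (Sh 1) ih
      simp only [map_mul, Sh_sRat, Sh_Sh] at ih'
      have e : ∀ u : ℝ, sRat (u + 1 - (i + 1 : ℕ)) (i + 1) =
          sRat (u + 1 - i - (1 : ℤ)) i * lin u := fun u => by
        rw [sRat_succ]
        congr 2 <;> (push_cast; ring)
      rw [e, e, Nat.cast_succ, seed₂, twistSeq_succ, ← seed₂, shiftOne_apply, weightRatio]
      have := lin_ne_zero N
      field_simp
      linear_combination lin (N + β) * ih'
  have hs : sRat (N - k + 1) k = sRat (N - k + 1) (k - i) * sRat (N + 1 - i) i := by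
    obtain ⟨d, rfl⟩ := Nat.exists_eq_add_of_le' hi
    rw [Nat.add_sub_cancel, sRat, sPoly_add, map_mul, sRat, sRat]
    congr 3
    push_cast
    ring
  rw [hs, mul_assoc, h, hahnRat, Sh_algebraMap, entry₂, polyShift_sPoly, map_mul, map_mul, sRat,
    sRat, Int.cast_natCast, mul_assoc]

variable (α β N : ℝ) (F₁ F₂ : Finset ℕ)

/-- The seed sequences of the Darboux transformation. -/
def seed : Fin (F₁.card + F₂.card) → ℤ → RatFunc ℝ :=
  Fin.append (fun a => seed₁ α β N (F₁.orderEmbOfFin rfl a))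
    (fun b => seed₂ α β N (F₂.orderEmbOfFin rfl b))

/-- The multipliers of the seed sequences under the shift. -/
def seedRatio : Fin (F₁.card + F₂.card) → RatFunc ℝ :=
  Fin.append (fun _ => 1) (fun _ => weightRatio β N)

/-- The points at which `lam` takes the eigenvalues of the seed sequences. -/
def seedPoint : Fin (F₁.card + F₂.card) → ℝ :=
  Fin.append (fun a => (F₁.orderEmbOfFin rfl a : ℝ)) (fun b => (F₂.orderEmbOfFin rfl b : ℝ) - β)

/-- The factors between the rows of the determinants and the seed sequences. -/
def rowFactor : Fin (F₁.card + F₂.card) → RatFunc ℝ :=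
  Fin.append (fun _ => 1)
    (fun _ => sRat (N - (F₁.card + F₂.card : ℕ) + 1) (F₁.card + F₂.card))

lemma rowFactor_mul_seed (a : Fin (F₁.card + F₂.card)) {i : ℕ} (hi : i ≤ F₁.card + F₂.card) :
    algebraMap ℝ[X] (RatFunc ℝ) (rows α β N F₁ F₂ a i) =
      rowFactor N F₁ F₂ a * seed α β N F₁ F₂ a i := by
  refine Fin.addCases (fun a => ?_) (fun b => ?_) a
  · simp only [rows, rowFactor, seed, Fin.append_left, one_mul, seed₁_natCast]
  · simp only [rows, rowFactor, seed, Fin.append_right, seed₂_natCast _ _ _ _ hi]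

lemma prod_rowFactor : ∏ a, rowFactor N F₁ F₂ a =
    sRat (N - (F₁.card + F₂.card : ℕ) + 1) (F₁.card + F₂.card) ^ F₂.card := by
  simp [rowFactor, Fin.prod_univ_add]

lemma prod_seedRatio : ∏ a, seedRatio β N F₁ F₂ a = weightRatio β N ^ F₂.card := by
  simp [seedRatio, Fin.prod_univ_add]

lemma seedRatio_ne_zero (a : Fin (F₁.card + F₂.card)) : seedRatio β N F₁ F₂ a ≠ 0 := by
  refine Fin.addCases (fun a => ?_) (fun b => ?_) a
  · simp [seedRatio]
  · simpa [seedRatio] using weightRatio_ne_zero β N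

lemma seed_succ (a : Fin (F₁.card + F₂.card)) (m : ℤ) :
    seed α β N F₁ F₂ a (m + 1) =
      seedRatio β N F₁ F₂ a * shiftOne (seed α β N F₁ F₂ a m) := by
  refine Fin.addCases (fun a => ?_) (fun b => ?_) a
  · simp only [seed, seedRatio, Fin.append_left]
    exact twistSeq_succ _ _ _
  · simp only [seed, seedRatio, Fin.append_right]
    exact twistSeq_succ _ _ _

variable {α β F₁ F₂}

lemma seqOp_seed (hα : ∀ m : ℕ, α ≠ -((m : ℝ) + 1)) (a : Fin (F₁.card + F₂.card)) :
    seqOp (hahnA α N) (hahnB α β N) (hahnC β N) (seed α β N F₁ F₂ a) =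
      RatFunc.C (lam α β (seedPoint β F₁ F₂ a)) • seed α β N F₁ F₂ a := by
  refine Fin.addCases (fun a => ?_) (fun b => ?_) a
  · simp only [seed, seedPoint, Fin.append_left, seqOp_seed₁ β N hα]
  · simp only [seed, seedPoint, Fin.append_right, seqOp_seed₂ β N hα]

lemma seed_zero_ne_zero (hα : ∀ m : ℕ, α ≠ -((m : ℝ) + 1))
    (hαβ : ∀ m : ℕ, α + β ≠ -((m : ℝ) + 1))
    (h₂ : F₂.Nonempty → ∀ m : ℕ, α - β ≠ -((m : ℝ) + 1)) (a : Fin (F₁.card + F₂.card)) :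
    seed α β N F₁ F₂ a 0 ≠ 0 := by
  refine Fin.addCases (fun a => ?_) (fun b => ?_) a
  · simp only [seed, Fin.append_left, seed₁, twistSeq_zero]
    exact hahnRat_ne_zero N hα hαβ _
  · simp only [seed, Fin.append_right, seed₂, twistSeq_zero]
    exact hahnRat_ne_zero _ hα (h₂ ⟨_, F₂.orderEmbOfFin_mem rfl b⟩) _

lemma lam_eq_lam_iff (α β x y : ℝ) :
    lam α β x = lam α β y ↔ x = y ∨ x + y = -(α + β + 1) := by
  have : lam α β x - lam α β y = (x - y) * (x + y + (α + β + 1)) := by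
    simp only [lam]
    ring
  rw [← sub_eq_zero, this, mul_eq_zero, sub_eq_zero, add_eq_zero_iff_eq_neg]

lemma lam_natCast_ne_lam_natCast (hαβ : ∀ m : ℕ, α + β ≠ -((m : ℝ) + 1)) {f g : ℕ} (h : f ≠ g) :
    lam α β f ≠ lam α β g := by
  rw [ne_eq, lam_eq_lam_iff]
  rintro (h' | h')
  · exact h (by exact_mod_cast h')
  · refine hαβ (f + g) ?_
    push_cast
    linarith

/-- A coincidence would mean `β = g - f`, excluded through `g ≤ max F₂`, or `α = -(f+g+1)`. -/
lemma lam_natCast_ne_lam_sub (hα : ∀ m : ℕ, α ≠ -((m : ℝ) + 1))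
    (h₂ : ∀ h : F₂.Nonempty, ∀ m : ℕ, β - (F₂.max' h : ℝ) - 1 ≠ -((m : ℝ) + 1))
    (f : ℕ) {g : ℕ} (hg : g ∈ F₂) : lam α β f ≠ lam α β (g - β) := by
  rw [ne_eq, lam_eq_lam_iff]
  rintro (h' | h')
  · have hle := F₂.le_max' g hg
    refine h₂ ⟨g, hg⟩ (F₂.max' ⟨g, hg⟩ - g + f) ?_
    push_cast [hle]
    linarith
  · refine hα (f + g) ?_
    push_cast
    linarith

lemma lam_sub_ne_lam_sub (h₂ : ∀ m : ℕ, α - β ≠ -((m : ℝ) + 1)) {f g : ℕ} (h : f ≠ g) :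
    lam α β (f - β) ≠ lam α β (g - β) := by
  rw [ne_eq, lam_eq_lam_iff]
  rintro (h' | h')
  · exact h (by exact_mod_cast (sub_left_inj.mp h'))
  · refine h₂ (f + g) ?_
    push_cast
    linarith

lemma lam_seedPoint_injective (hα : ∀ m : ℕ, α ≠ -((m : ℝ) + 1))
    (hαβ : ∀ m : ℕ, α + β ≠ -((m : ℝ) + 1))
    (h₂ : ∀ h : F₂.Nonempty, ∀ m : ℕ,
      α - β ≠ -((m : ℝ) + 1) ∧ β - (F₂.max' h : ℝ) - 1 ≠ -((m : ℝ) + 1)) :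
    Function.Injective fun a => RatFunc.C (lam α β (seedPoint β F₁ F₂ a)) := by
  suffices h : Function.Injective fun a => lam α β (seedPoint β F₁ F₂ a) from
    (RatFunc.C (K := ℝ)).injective.comp h
  have e : (fun a => lam α β (seedPoint β F₁ F₂ a)) =
      Fin.append (fun a => lam α β (F₁.orderEmbOfFin rfl a : ℝ))
        (fun b => lam α β ((F₂.orderEmbOfFin rfl b : ℝ) - β)) := by
    ext a
    refine Fin.addCases (fun a => ?_) (fun b => ?_) a <;> simp [seedPoint]
  rw [e, Fin.append_injective_iff]
  refine ⟨fun a a' h => ?_, fun b b' h => ?_, fun a b => ?_⟩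
  · by_contra hne
    exact lam_natCast_ne_lam_natCast hαβ (fun h' => hne ((F₁.orderEmbOfFin rfl).injective h')) h
  · by_contra hne
    exact lam_sub_ne_lam_sub (fun m => (h₂ ⟨_, F₂.orderEmbOfFin_mem rfl b⟩ m).1)
      (fun h' => hne ((F₂.orderEmbOfFin rfl).injective h')) h
  · exact lam_natCast_ne_lam_sub hα (fun h m => (h₂ h m).2) _ (F₂.orderEmbOfFin_mem rfl b)

lemma C_lam_ne_seedPoint (hα : ∀ m : ℕ, α ≠ -((m : ℝ) + 1))
    (hαβ : ∀ m : ℕ, α + β ≠ -((m : ℝ) + 1))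
    (h₂ : ∀ h : F₂.Nonempty, ∀ m : ℕ,
      α - β ≠ -((m : ℝ) + 1) ∧ β - (F₂.max' h : ℝ) - 1 ≠ -((m : ℝ) + 1))
    {n : ℕ} (hn : n ∉ F₁) (a : Fin (F₁.card + F₂.card)) :
    RatFunc.C (lam α β (seedPoint β F₁ F₂ a)) ≠ RatFunc.C (lam α β n) := by
  refine fun h => absurd ((RatFunc.C (K := ℝ)).injective h) ?_
  refine Fin.addCases (fun a => ?_) (fun b => ?_) a
  · simp only [seedPoint, Fin.append_left]
    exact lam_natCast_ne_lam_natCast hαβ fun h => hn (h ▸ F₁.orderEmbOfFin_mem rfl a)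
  · simp only [seedPoint, Fin.append_right]
    exact (lam_natCast_ne_lam_sub hα (fun h m => (h₂ h m).2) _ (F₂.orderEmbOfFin_mem rfl b)).symm

end Seeds

/-! ### The objects of the theorem as Casorati determinants, and how they shift. -/

section Main

variable {α β N : ℝ} {F₁ F₂ : Finset ℕ}

variable (α β N F₁ F₂) in
/-- The determinant of the seeds on the columns `0, …, k-2, k`, translated by `m`. -/
def seedGap (m : ℤ) : RatFunc ℝ :=
  Matrix.det (Matrix.of fun a b : Fin (F₁.card + F₂.card) => seed α β N F₁ F₂ a
    (m + ((if (b : ℕ) + 1 = F₁.card + F₂.card then F₁.card + F₂.card else (b : ℕ) : ℕ) : ℤ)))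

lemma algebraMap_det_rows {c : Fin (F₁.card + F₂.card) → ℕ} (hc : ∀ b, c b ≤ F₁.card + F₂.card) :
    algebraMap ℝ[X] (RatFunc ℝ) (Matrix.det (Matrix.of fun a i => rows α β N F₁ F₂ a (c i))) =
      sRat (N - (F₁.card + F₂.card : ℕ) + 1) (F₁.card + F₂.card) ^ F₂.card *
        Matrix.det (Matrix.of fun a i => seed α β N F₁ F₂ a (0 + (c i : ℤ))) := by
  rw [RingHom.map_det, ← prod_rowFactor, ← Matrix.det_mul_column]
  refine congrArg Matrix.det (Matrix.ext fun a b => ?_)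
  simp only [RingHom.mapMatrix_apply, Matrix.map_apply, Matrix.of_apply,
    rowFactor_mul_seed α β N F₁ F₂ a (hc b), zero_add]

lemma Omega_eq : Omega α β N F₁ F₂ =
    sRat (N - (F₁.card + F₂.card : ℕ) + 1) (F₁.card + F₂.card) ^ F₂.card *
      casorati (seed α β N F₁ F₂) 0 /
      algebraMap ℝ[X] (RatFunc ℝ) (denΩ β N (F₁.card + F₂.card) F₂.card) := by
  rw [Omega, algebraMap_det_rows (fun b => b.2.le), casorati]

lemma Lambda_eq : Lambda α β N F₁ F₂ =
    sRat (N - (F₁.card + F₂.card : ℕ) + 1) (F₁.card + F₂.card) ^ F₂.card *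
      seedGap α β N F₁ F₂ 0 /
      algebraMap ℝ[X] (RatFunc ℝ) (denΩ β N (F₁.card + F₂.card) F₂.card) := by
  rw [Lambda, algebraMap_det_rows (fun b => by have := b.2; split_ifs <;> omega), seedGap]

lemma hF_eq (n : ℕ) : hF α β N F₁ F₂ n =
    sRat (N - (F₁.card + F₂.card : ℕ) + 1) (F₁.card + F₂.card) ^ F₂.card *
      casoratiOp (seed α β N F₁ F₂) 0 (seed₁ α β N (n - uF F₁ F₂)) /
      algebraMap ℝ[X] (RatFunc ℝ) (denH β N (F₁.card + F₂.card) F₂.card) := by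
  -- The added top row is a seed of the first kind and needs no rescaling, hence the entry `1`.
  have hprod : sRat (N - (F₁.card + F₂.card : ℕ) + 1) (F₁.card + F₂.card) ^ F₂.card =
      ∏ a, (Fin.cons 1 (rowFactor N F₁ F₂) : Fin (F₁.card + F₂.card + 1) → RatFunc ℝ) a := by
    rw [Fin.prod_univ_succ]
    simp [prod_rowFactor]
  rw [hF, RingHom.map_det, casoratiOp_eq_casorati, casorati, hprod, ← Matrix.det_mul_column]
  congr 1
  refine congrArg Matrix.det (Matrix.ext fun a b => ?_)
  simp only [RingHom.mapMatrix_apply, Matrix.map_apply, Matrix.of_apply, zero_add]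
  refine Fin.cases ?_ (fun a => ?_) a
  · simp only [Fin.cons_zero, one_mul, seed₁_natCast]
  · simp only [Fin.cons_succ, rowFactor_mul_seed α β N F₁ F₂ a (Nat.lt_succ_iff.mp b.2)]

lemma casorati_seed_ne_zero (hα : ∀ m : ℕ, α ≠ -((m : ℝ) + 1))
    (hαβ : ∀ m : ℕ, α + β ≠ -((m : ℝ) + 1))
    (h₂ : ∀ h : F₂.Nonempty, ∀ m : ℕ,
      α - β ≠ -((m : ℝ) + 1) ∧ β - (F₂.max' h : ℝ) - 1 ≠ -((m : ℝ) + 1)) (m : ℤ) :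
    casorati (seed α β N F₁ F₂) m ≠ 0 := by
  refine casorati_ne_zero (seedRatio_ne_zero β N F₁ F₂) (seed_succ α β N F₁ F₂)
    (Module.End.eigenvectors_linearIndependent' (seqOp (hahnA α N) (hahnB α β N) (hahnC β N)) _
      (lam_seedPoint_injective hα hαβ h₂) _ fun a => ⟨?_, ?_⟩) m
  · exact Module.End.mem_eigenspace_iff.mpr (seqOp_seed N hα a)
  · exact fun h => seed_zero_ne_zero N hα hαβ (fun h m => (h₂ h m).1) a (congrFun h 0)

lemma seedRatio_cons_ne_zero (a : Fin (F₁.card + F₂.card + 1)) :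
    (Fin.cons 1 (seedRatio β N F₁ F₂) : Fin (F₁.card + F₂.card + 1) → RatFunc ℝ) a ≠ 0 := by
  refine Fin.cases ?_ (fun a => ?_) a
  · simp
  · simpa using seedRatio_ne_zero β N F₁ F₂ a

lemma seed_cons_succ (n : ℕ) (a : Fin (F₁.card + F₂.card + 1)) (m : ℤ) :
    (Fin.cons (seed₁ α β N n) (seed α β N F₁ F₂) :
      Fin (F₁.card + F₂.card + 1) → ℤ → RatFunc ℝ) a (m + 1) =
    (Fin.cons 1 (seedRatio β N F₁ F₂) : Fin (F₁.card + F₂.card + 1) → RatFunc ℝ) a *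
      shiftOne ((Fin.cons (seed₁ α β N n) (seed α β N F₁ F₂) :
        Fin (F₁.card + F₂.card + 1) → ℤ → RatFunc ℝ) a m) := by
  refine Fin.cases ?_ (fun a => ?_) a
  · simp only [Fin.cons_zero]
    exact twistSeq_succ _ _ _
  · simp only [Fin.cons_succ]
    exact seed_succ α β N F₁ F₂ a m

/-- For `n ∉ F₁` the sequence of `h_n` is one more eigenvector with a new eigenvalue, so the
bordered determinant is again that of an independent family. -/
lemma casoratiOp_seed_ne_zero (hα : ∀ m : ℕ, α ≠ -((m : ℝ) + 1))
    (hαβ : ∀ m : ℕ, α + β ≠ -((m : ℝ) + 1))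
    (h₂ : ∀ h : F₂.Nonempty, ∀ m : ℕ,
      α - β ≠ -((m : ℝ) + 1) ∧ β - (F₂.max' h : ℝ) - 1 ≠ -((m : ℝ) + 1))
    {n : ℕ} (hn : n ∉ F₁) (m : ℤ) :
    casoratiOp (seed α β N F₁ F₂) m (seed₁ α β N n) ≠ 0 := by
  rw [casoratiOp_eq_casorati]
  refine casorati_ne_zero seedRatio_cons_ne_zero (seed_cons_succ n)
    (Module.End.eigenvectors_linearIndependent' (seqOp (hahnA α N) (hahnB α β N) (hahnC β N))
      (Fin.cons (RatFunc.C (lam α β n)) fun a => RatFunc.C (lam α β (seedPoint β F₁ F₂ a)))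
      (Fin.cons_injective_iff.mpr ⟨?_, lam_seedPoint_injective hα hαβ h₂⟩) _
      (Fin.cases ⟨?_, ?_⟩ fun a => ⟨?_, ?_⟩)) m
  · rintro ⟨a, ha⟩
    exact C_lam_ne_seedPoint hα hαβ h₂ hn a ha
  · simpa only [Fin.cons_zero] using
      Module.End.mem_eigenspace_iff.mpr (seqOp_seed₁ β N hα n)
  · intro h
    have := congrFun h 0
    simp only [Fin.cons_zero, seed₁, twistSeq_zero, Pi.zero_apply] at this
    exact hahnRat_ne_zero N hα hαβ n this
  · simpa only [Fin.cons_succ] using Module.End.mem_eigenspace_iff.mpr (seqOp_seed N hα a)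
  · intro h
    exact seed_zero_ne_zero N hα hαβ (fun h m => (h₂ h m).1) a (congrFun h 0)

lemma casorati_seed_succ (m : ℤ) : casorati (seed α β N F₁ F₂) (m + 1) =
    weightRatio β N ^ F₂.card * Sh 1 (casorati (seed α β N F₁ F₂) m) := by
  rw [casorati_semilinear (seed_succ α β N F₁ F₂), prod_seedRatio, shiftOne_apply]

lemma casoratiOp_seed_succ (n : ℕ) (m : ℤ) :
    casoratiOp (seed α β N F₁ F₂) (m + 1) (seed₁ α β N n) =
      weightRatio β N ^ F₂.card *
        Sh 1 (casoratiOp (seed α β N F₁ F₂) m (seed₁ α β N n)) := by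
  rw [casoratiOp_eq_casorati, casorati_semilinear (seed_cons_succ n), ← casoratiOp_eq_casorati,
    Fin.prod_univ_succ, shiftOne_apply]
  simp [prod_seedRatio]

lemma seedGap_succ (m : ℤ) : seedGap α β N F₁ F₂ (m + 1) =
    weightRatio β N ^ F₂.card * Sh 1 (seedGap α β N F₁ F₂ m) := by
  rw [← shiftOne_apply, seedGap, seedGap, RingEquiv.map_det, ← prod_seedRatio β N F₁ F₂,
    ← Matrix.det_mul_column]
  refine congrArg Matrix.det (Matrix.ext fun a b => ?_)
  simp only [Matrix.of_apply, RingEquiv.mapMatrix_apply, Matrix.map_apply, ← seed_succ]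
  congr 1
  ring

/-- This converts the factor `x-N+k` of the Crum operator into the factor `x-N+k₁` of `h_1`. The two
products differ by `(N-k+1-x)_{k₂}`, whose shift trades one end factor for the other. -/
lemma lin_mul_Sh_denΩ :
    lin (N - F₁.card) *
      Sh 1 (algebraMap ℝ[X] (RatFunc ℝ) (denΩ β N (F₁.card + F₂.card) F₂.card)) *
      algebraMap ℝ[X] (RatFunc ℝ) (denH β N (F₁.card + F₂.card) F₂.card) =
    lin (N - (F₁.card + F₂.card : ℕ)) *
      algebraMap ℝ[X] (RatFunc ℝ) (denΩ β N (F₁.card + F₂.card) F₂.card) *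
      Sh 1 (algebraMap ℝ[X] (RatFunc ℝ) (denH β N (F₁.card + F₂.card) F₂.card)) := by
  rw [denΩ_eq_mul_denH, map_mul, map_mul, ← sRat, Sh_sRat, Int.cast_one]
  have h := sRat_sub_one (N - (F₁.card + F₂.card : ℕ) + 1) F₂.card
  rw [add_sub_cancel_right] at h ⊢
  rw [show N - (F₁.card + F₂.card : ℕ) + (F₂.card : ℝ) = N - F₁.card by push_cast; ring] at h
  generalize algebraMap ℝ[X] (RatFunc ℝ) (denH β N (F₁.card + F₂.card) F₂.card) = d
  linear_combination (Sh 1 d * d) * h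

lemma sRat_Sh_mul (k : ℕ) :
    Sh 1 (sRat (N - k + 1) k) * Sh (-1) (sRat (N - k + 1) k) * Sh (-1) (weightRatio β N) *
      (lin (N - k + 1) * lin (N + β + 1 - 1)) =
    sRat (N - k + 1) k ^ 2 * weightRatio β N * (lin (N - k + 1 - 1) * lin (N + β + 1)) := by
  have h1 := sRat_sub_one (N - k + 1) k
  have h2 := sRat_sub_one (N - k + 1 + 1) k
  rw [show N - k + 1 - 1 + (k : ℝ) = N by ring] at h1
  rw [add_sub_cancel_right, show N - k + 1 + (k : ℝ) = N + 1 by ring] at h2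
  simp only [weightRatio, map_div₀, Sh_sRat, Sh_lin, Int.cast_one, Int.cast_neg, sub_neg_eq_add]
  have h3 := lin_ne_zero N
  have h4 := lin_ne_zero (N + 1)
  rw [add_sub_cancel_right (N + β)]
  field_simp
  linear_combination lin (N + β + 1) * lin (N + β) *
    ((lin (N - k + 1) * sRat (N - k + 1 + 1) k) * h1 -
      (lin (N - k + 1 - 1) * sRat (N - k + 1) k) * h2)

/-- The counterpart for `h_{-1}`: it converts `x-β-N-1` into `x-β-N-1+k₂`, now also accounting for
the row factors and the weight ratio. -/
lemma lin_mul_Sh_den (k k₂ : ℕ) :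
    lin (N + β + 1 - k₂) * Sh 1 (sRat (N - k + 1) k ^ k₂) * Sh (-1) (sRat (N - k + 1) k ^ k₂) *
      Sh (-1) (weightRatio β N ^ k₂) *
      algebraMap ℝ[X] (RatFunc ℝ) (denΩ β N k k₂) * algebraMap ℝ[X] (RatFunc ℝ) (denH β N k k₂) =
    lin (N + β + 1) * (sRat (N - k + 1) k ^ k₂) ^ 2 * weightRatio β N ^ k₂ *
      Sh 1 (algebraMap ℝ[X] (RatFunc ℝ) (denΩ β N k k₂)) *
      Sh (-1) (algebraMap ℝ[X] (RatFunc ℝ) (denH β N k k₂)) := by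
  have h1 := congrArg (· ^ k₂) (sRat_Sh_mul (β := β) (N := N) k)
  have h2 := factor_quotient (N - k + 1) (N + β + 1) k₂
  have hΩ : algebraMap ℝ[X] (RatFunc ℝ) (denΩ β N k k₂) =
      (∏ j ∈ Finset.range k₂, sRat (N - k + 1) (j + 1)) *
        ∏ j ∈ Finset.range k₂, sRat (N + β + 1 - j) j := by
    rw [denΩ_eq, map_mul, map_prod, map_prod]
    rfl
  have hH : algebraMap ℝ[X] (RatFunc ℝ) (denH β N k k₂) =
      (∏ j ∈ Finset.range k₂, sRat (N - k + 1) j) *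
        ∏ j ∈ Finset.range k₂, sRat (N + β + 1 - j) j := by
    rw [denH_eq, map_mul, map_prod, map_prod]
    rfl
  rw [← hΩ, ← hH] at h2
  have hk : (lin (N - k + 1 - 1) * lin (N + β + 1)) ^ k₂ ≠ 0 :=
    pow_ne_zero _ (mul_ne_zero (lin_ne_zero _) (lin_ne_zero _))
  have hk' : (lin (N - k + 1) * lin (N + β + 1 - 1)) ^ k₂ ≠ 0 :=
    pow_ne_zero _ (mul_ne_zero (lin_ne_zero _) (lin_ne_zero _))
  simp only [mul_pow _ (lin (N - k + 1) * lin (N + β + 1 - 1)),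
    mul_pow _ (lin (N - k + 1 - 1) * lin (N + β + 1))] at h1
  generalize (lin (N - k + 1 - 1) * lin (N + β + 1)) ^ k₂ = a at *
  generalize (lin (N - k + 1) * lin (N + β + 1 - 1)) ^ k₂ = b at *
  refine mul_right_cancel₀ (mul_ne_zero hk hk') ?_
  simp only [map_pow, mul_pow] at *
  generalize algebraMap ℝ[X] (RatFunc ℝ) (denΩ β N k k₂) = p at *
  generalize algebraMap ℝ[X] (RatFunc ℝ) (denH β N k k₂) = q at *
  linear_combination (lin (N + β + 1 - k₂) * p * q * a) * h1 +
    ((sRat (N - k + 1) k ^ 2) ^ k₂ * weightRatio β N ^ k₂ * a) * h2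

end Main

/-! ### The eigenvalue equation. -/

section Eigen

variable {α β N : ℝ} {F₁ F₂ : Finset ℕ}

lemma coeffOne_eq : coeffOne α β N F₁ F₂ =
    lin (-α - 1 - (F₁.card + F₂.card : ℕ)) * lin (N - F₁.card) * Omega α β N F₁ F₂ /
      Sh 1 (Omega α β N F₁ F₂) := by
  rw [coeffOne, X_add_C_eq, X_add_C_eq, neg_mul_neg]
  congr 4 <;> ring

lemma coeffNegOne_eq : coeffNegOne α β N F₁ F₂ =
    lin 0 * lin (N + β + 1 - F₂.card) * Sh 1 (Omega α β N F₁ F₂) / Omega α β N F₁ F₂ := by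
  have h : (RatFunc.X : RatFunc ℝ) = -lin 0 := by simp [lin]
  rw [coeffNegOne, X_add_C_eq]
  nth_rewrite 1 [h]
  rw [neg_mul_neg]
  congr 4
  ring

lemma coeffZero_eq : coeffZero α β N F₁ F₂ =
    hahnB α β N (F₁.card + F₂.card : ℕ) +
      hahnA α N (F₁.card + F₂.card : ℕ) *
        Sh 1 (Lambda α β N F₁ F₂ / Omega α β N F₁ F₂) -
      hahnA α N ((F₁.card + F₂.card : ℕ) - 1) *
        (Lambda α β N F₁ F₂ / Omega α β N F₁ F₂) := by
  generalize hk : F₁.card + F₂.card = k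
  have h := hahnA_succ α N ((k : ℤ) - 1)
  rw [sub_add_cancel, shiftOne_apply] at h
  have e1 : (RatFunc.X + RatFunc.C (α + (k : ℝ))) * (RatFunc.X + RatFunc.C (-N - 1 + (k : ℝ))) =
      hahnA α N ((k : ℤ) - 1) := by
    rw [X_add_C_eq, X_add_C_eq, neg_mul_neg, hahnA]
    congr 2 <;> (push_cast; ring)
  have e2 : (RatFunc.X + RatFunc.C (α + 1 + (k : ℝ))) * (RatFunc.X + RatFunc.C (-N + (k : ℝ))) =
      hahnA α N k := by
    rw [X_add_C_eq, X_add_C_eq, neg_mul_neg, hahnA]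
    congr 2 <;> (push_cast; ring)
  have e3 : (RatFunc.X + RatFunc.C (k : ℝ)) * (RatFunc.X + RatFunc.C (-β - N - 1 + (k : ℝ))) =
      hahnC β N k := by
    rw [X_add_C_eq, X_add_C_eq, neg_mul_neg, hahnC]
    congr 2
    push_cast
    ring
  rw [coeffZero, hk, e1, e2, e3, Delta, hahnB, mul_div_assoc, map_mul, ← h]
  ring

/-- This is `crum` applied to the sequence of `h_{n-u}`, multiplied by `U / dH`, the ratio of row
factors to `denH`. Values at `m = ±1` are traded for shifts of values at `0` or `-1` by
semilinearity. -/
lemma DF_hF (hk : 0 < F₁.card + F₂.card) (hα : ∀ m : ℕ, α ≠ -((m : ℝ) + 1))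
    (hαβ : ∀ m : ℕ, α + β ≠ -((m : ℝ) + 1))
    (h₂ : ∀ h : F₂.Nonempty, ∀ m : ℕ,
      α - β ≠ -((m : ℝ) + 1) ∧ β - (F₂.max' h : ℝ) - 1 ≠ -((m : ℝ) + 1)) (n : ℕ) :
    DF α β N F₁ F₂ (hF α β N F₁ F₂ n) =
      RatFunc.C (lam α β (n - uF F₁ F₂ : ℕ)) * hF α β N F₁ F₂ n := by
  have hW := casorati_seed_ne_zero (N := N) (F₁ := F₁) hα hαβ h₂
  have hcrum := crum hk hW (seqOp_seed N hα) (seed₁ α β N (n - uF F₁ F₂))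
  rw [seqOp_seed₁ β N hα, map_smul, smul_eq_mul] at hcrum
  have hgap : ∀ m : ℤ, Matrix.det (Matrix.of fun a b : Fin (F₁.card + F₂.card) =>
      seed α β N F₁ F₂ a (m + ((if (b : ℕ) + 1 = F₁.card + F₂.card then F₁.card + F₂.card
        else (b : ℕ) : ℕ) : ℤ))) = seedGap α β N F₁ F₂ m := fun m => rfl
  simp only [hgap] at hcrum
  have hW0 := hW 0
  have sW := casorati_seed_succ (α := α) (β := β) (N := N) (F₁ := F₁) (F₂ := F₂) 0
  have sG := seedGap_succ (α := α) (β := β) (N := N) (F₁ := F₁) (F₂ := F₂) 0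
  have sV := casoratiOp_seed_succ (α := α) (β := β) (N := N) (F₁ := F₁) (F₂ := F₂) (n - uF F₁ F₂) 0
  have sV' := congrArg (Sh (-1)) (casoratiOp_seed_succ (α := α) (β := β) (N := N) (F₁ := F₁)
    (F₂ := F₂) (n - uF F₁ F₂) (-1))
  rw [zero_add] at sW sG sV
  rw [map_mul, Sh_Sh, add_neg_cancel, Sh_zero, neg_add_cancel] at sV'
  have hA : hahnA α N (F₁.card + F₂.card : ℕ) =
      lin (-α - 1 - (F₁.card + F₂.card : ℕ)) * lin (N - (F₁.card + F₂.card : ℕ)) := by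
    rw [hahnA, Int.cast_natCast]
  have hC : hahnC β N 0 = lin 0 * lin (N + β + 1) := by
    rw [hahnC, Int.cast_zero, neg_zero, sub_zero, add_comm β N]
  have hB : coeffZero α β N F₁ F₂ = hahnB α β N (F₁.card + F₂.card : ℕ) +
      hahnA α N (F₁.card + F₂.card : ℕ) * seedGap α β N F₁ F₂ 1 /
        casorati (seed α β N F₁ F₂) 1 -
      hahnA α N ((F₁.card + F₂.card : ℕ) - 1) * seedGap α β N F₁ F₂ 0 /
        casorati (seed α β N F₁ F₂) 0 := by
    have hq : Lambda α β N F₁ F₂ / Omega α β N F₁ F₂ =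
        seedGap α β N F₁ F₂ 0 / casorati (seed α β N F₁ F₂) 0 := by
      rw [Lambda_eq, Omega_eq, div_div_div_cancel_right₀
        (RatFunc.algebraMap_ne_zero (denΩ_ne_zero _ _ _ _)),
        mul_div_mul_left _ _ (pow_ne_zero _ (sRat_ne_zero _ _))]
    -- Both determinants pick up the same power of the weight ratio under the shift, so it cancels
    -- here, and `h_0` agrees with the middle Crum coefficient without correction.
    have hq1 : Sh 1 (seedGap α β N F₁ F₂ 0) / Sh 1 (casorati (seed α β N F₁ F₂) 0) =
        seedGap α β N F₁ F₂ 1 / casorati (seed α β N F₁ F₂) 1 := by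
      rw [sW, sG, mul_div_mul_left _ _ (pow_ne_zero _ (weightRatio_ne_zero β N))]
    rw [coeffZero_eq, hq, map_div₀, hq1, mul_div_assoc, mul_div_assoc]
  rw [← hB] at hcrum
  have t1 := lin_mul_Sh_denΩ (β := β) (N := N) (F₁ := F₁) (F₂ := F₂)
  have t2 := lin_mul_Sh_den (β := β) (N := N) (F₁.card + F₂.card) F₂.card
  have hR : weightRatio β N ^ F₂.card ≠ 0 := pow_ne_zero _ (weightRatio_ne_zero β N)
  have hU : sRat (N - (F₁.card + F₂.card : ℕ) + 1) (F₁.card + F₂.card) ^ F₂.card ≠ 0 :=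
    pow_ne_zero _ (sRat_ne_zero _ _)
  have hdΩ : algebraMap ℝ[X] (RatFunc ℝ) (denΩ β N (F₁.card + F₂.card) F₂.card) ≠ 0 :=
    RatFunc.algebraMap_ne_zero (denΩ_ne_zero _ _ _ _)
  have hdH : algebraMap ℝ[X] (RatFunc ℝ) (denH β N (F₁.card + F₂.card) F₂.card) ≠ 0 :=
    RatFunc.algebraMap_ne_zero (denH_ne_zero _ _ _ _)
  have hSh : ∀ (l : ℤ) {f : RatFunc ℝ}, f ≠ 0 → Sh l f ≠ 0 := fun l f hf =>
    (map_ne_zero_iff (Sh l) (Sh l).injective).mpr hf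
  have hDF : DF α β N F₁ F₂ (hF α β N F₁ F₂ n) =
      coeffNegOne α β N F₁ F₂ * Sh (-1) (hF α β N F₁ F₂ n) +
        coeffZero α β N F₁ F₂ * hF α β N F₁ F₂ n +
        coeffOne α β N F₁ F₂ * Sh 1 (hF α β N F₁ F₂ n) := by
    simp [DF, Sh_zero]
  have hSW : Sh 1 (casorati (seed α β N F₁ F₂) 0) ≠ 0 := hSh 1 hW0
  rw [hDF, coeffNegOne_eq, coeffOne_eq, hF_eq, Omega_eq]
  rw [hA, hC, sV, sW] at hcrum
  simp only [map_div₀, map_mul] at hcrum t1 t2 ⊢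
  rw [sV']
  have hU1 := hSh 1 hU
  have hdΩ1 := hSh 1 hdΩ
  have hdH1 := hSh 1 hdH
  have hdHm := hSh (-1) hdH
  generalize sRat (N - (F₁.card + F₂.card : ℕ) + 1) (F₁.card + F₂.card) ^ F₂.card = U at *
  generalize weightRatio β N ^ F₂.card = R at *
  generalize algebraMap ℝ[X] (RatFunc ℝ) (denΩ β N (F₁.card + F₂.card) F₂.card) = dΩ at *
  generalize algebraMap ℝ[X] (RatFunc ℝ) (denH β N (F₁.card + F₂.card) F₂.card) = dH at *
  generalize casoratiOp (seed α β N F₁ F₂) 0 (seed₁ α β N (n - uF F₁ F₂)) = V at *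
  generalize casoratiOp (seed α β N F₁ F₂) (-1) (seed₁ α β N (n - uF F₁ F₂)) = Vm at *
  generalize casorati (seed α β N F₁ F₂) 0 = W at *
  generalize coeffZero α β N F₁ F₂ = b at *
  generalize lin (-α - 1 - (F₁.card + F₂.card : ℕ)) = l₁ at *
  generalize lin (N - F₁.card) = l₂ at *
  generalize lin (N - (F₁.card + F₂.card : ℕ)) = l₃ at *
  generalize lin (N + β + 1 - F₂.card) = l₄ at *
  generalize lin (N + β + 1) = l₅ at *
  have hlow : lin 0 * l₄ * (Sh 1 U * Sh 1 W / Sh 1 dΩ) / (U * W / dΩ) *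
      (Sh (-1) U * (Sh (-1) R * Vm) / Sh (-1) dH) =
      U / dH * (lin 0 * l₅ * (R * Sh 1 W) / W * Vm) := by
    field_simp
    linear_combination lin 0 * Vm * t2
  have htop : l₁ * l₂ * (U * W / dΩ) / (Sh 1 U * Sh 1 W / Sh 1 dΩ) *
      (Sh 1 U * Sh 1 V / Sh 1 dH) =
      U / dH * (l₁ * l₃ * W / (R * Sh 1 W) * (R * Sh 1 V)) := by
    field_simp
    linear_combination l₁ * Sh 1 V * t1
  rw [hlow, htop]
  linear_combination U / dH * hcrum

end Eigen

end ExcHahn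

end

/-! ### The theorem. -/

theorem theorem3p3 (α β N : ℝ) (F₁ F₂ : Finset ℕ)
    (hF₁ : ∀ f ∈ F₁, 0 < f) (hF₂ : ∀ f ∈ F₂, 0 < f)
    (hF : F₁.Nonempty ∨ F₂.Nonempty)
    (hα : ∀ m : ℕ, α ≠ -((m : ℝ) + 1)) (hβ : ∀ m : ℕ, β ≠ -((m : ℝ) + 1))
    (hαβ : ∀ m : ℕ, α + β ≠ -((m : ℝ) + 1))
    (h₂ : ∀ h : F₂.Nonempty, ∀ m : ℕ,
      α - β ≠ -((m : ℝ) + 1) ∧ β - (F₂.max' h : ℝ) - 1 ≠ -((m : ℝ) + 1)) :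
    ExcHahn.Omega α β N F₁ F₂ ≠ 0 ∧
    ∀ n ∈ ExcHahn.sigmaF F₁ F₂,
      (∃ p : Polynomial ℝ,
        ExcHahn.hF α β N F₁ F₂ n = algebraMap (Polynomial ℝ) (RatFunc ℝ) p) ∧
      Module.End.HasEigenvector (ExcHahn.DF α β N F₁ F₂)
        (ExcHahn.lam α β ((n : ℝ) - (ExcHahn.uF F₁ F₂ : ℝ)))
        (ExcHahn.hF α β N F₁ F₂ n) := by
  have hW := ExcHahn.casorati_seed_ne_zero (N := N) (F₁ := F₁) hα hαβ h₂
  have hk : 0 < F₁.card + F₂.card := by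
    rcases hF with h | h <;> have := h.card_pos <;> omega
  refine ⟨?_, fun n hn => ⟨?_, ?_, ?_⟩⟩
  · rw [ExcHahn.Omega_eq]
    exact div_ne_zero (mul_ne_zero (pow_ne_zero _ (ExcHahn.sRat_ne_zero _ _)) (hW 0))
      (RatFunc.algebraMap_ne_zero (ExcHahn.denΩ_ne_zero _ _ _ _))
  · obtain ⟨p, hp⟩ := ExcHahn.denH_dvd_det α β N F₁ F₂
      (ExcHahn.entry₁ α β N (n - ExcHahn.uF F₁ F₂))
    refine ⟨p, ?_⟩
    rw [ExcHahn.hF, hp, map_mul, mul_div_cancel_left₀]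
    exact RatFunc.algebraMap_ne_zero (ExcHahn.denH_ne_zero _ _ _ _)
  · rw [Module.End.mem_eigenspace_iff, ExcHahn.DF_hF hk hα hαβ h₂, Nat.cast_sub hn.1,
      RatFunc.smul_eq_C_mul]
  · rw [ExcHahn.hF_eq]
    refine div_ne_zero (mul_ne_zero (pow_ne_zero _ (ExcHahn.sRat_ne_zero _ _))
      (ExcHahn.casoratiOp_seed_ne_zero hα hαβ h₂ (fun h => hn.2 _ h ?_) 0))
      (RatFunc.algebraMap_ne_zero (ExcHahn.denH_ne_zero _ _ _ _))
    have := hn.1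
    omega
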